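/- Let $\Lambda$ be either the infinite lattice $\mathbb{Z}^4$ or a finite cube $\Lambda_j=[-j,j]^4\cap\mathbb{Z}^4$. A $k$-form on $\Lambda$ is a real function $f$ on the oriented $k$-cells of $\Lambda$ with $f(w^{-1})=-f(w)$; put $\langle f,g\rangle=\sum_w f(w)g(w)$, the sum running over the positively oriented $k$-cells, and $\|f\|^2=\langle f,f\rangle$. For a $1$-form $\theta$ let $\mathrm d\theta(p)=\sum_{e\in\partial p}\theta(e)$ be its discrete exterior derivative. Let $\Omega^{1\to2}$ be the space of the $2$-forms $\mathrm d\theta$ with $\|\mathrm d\theta\|<\infty$ ($\theta$ a $1$-form on $\Lambda$), let $\mathring\Omega^{1\to2}$ be the same space with $\theta$ required to vanish on all edges contained in the boundary of the cube (so $\mathring\Omega^{1\to2}=\Omega^{1\to2}$ if $\Lambda=\mathbb{Z}^4$), and let $P_{1\to2}$ (free boundary condition) and $\mathring P_{1\to2}$ (zero boundary condition) be the orthogonal projections onto these closed spaces. For every $b>0$ there are constants $C=C(b)>0$ and $D=D(b)<\infty$ such that the following holds for every such $\Lambda$ and every two-dimensional axis-parallel lattice rectangle $R$ in $\Lambda$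 with length $L$ and height $H$, $L^{3/4}\le H\le L^{4/3}$, whose distance to the boundary of $\Lambda$ is bigger than $L$ and bigger than $D$ (no condition if $\Lambda=\mathbb{Z}^4$). If $\mathbf 1_R$ is the $2$-form which is $1$ on the positively oriented $2$-cells contained in $R$ and $0$ on those not contained in $R$, then $$\big\|(P_{1\to2}\mathbf 1_R)\,\mathbf 1_{|P_{1\to2}\mathbf 1_R|<b}\big\|^2\ \ge\ C\,\big\|P_{1\to2}\mathbf 1_R\big\|^2 \quad\text{and}\quad \big\|(\mathring P_{1\to2}\mathbf 1_R)\,\mathbf 1_{|\mathring P_{1\to2}\mathbf 1_R|<b}\big\|^2\ \ge\ C\,\big\|\mathring P_{1\to2}\mathbf 1_R\big\|^2 .$$ -/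

import Mathlib

/-!
Discrete `1`- and `2`-forms on the graphs `Λ_j = [-j, j]⁴ ∩ ℤ⁴` and on `ℤ⁴`, the exterior
derivative, the orthogonal projection onto exact `2`-forms (free and zero boundary conditions)
and the indicator `2`-form of a rectangle.

A `k`-form is an antisymmetric function of oriented `k`-cells; as usual it is recorded by its
values on the positively oriented cells.
-/

namespace LatticeGauge

/-- Points of `ℤ⁴`. -/
abbrev Vertex : Type := Fin 4 → ℤ

/-- The canonical basis of `ℤ⁴`. -/
def unitVec (i : Fin 4) : Vertex := Pi.single i 1

/-- `InBox j x`: the point `x` is a vertex of `Λ_j`. Here `j : ℕ∞`, so that `Λ_j` is the cube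
`[-j, j]⁴ ∩ ℤ⁴` for finite `j`, and the whole lattice `ℤ⁴` for `j = ⊤`. -/
def InBox (j : ℕ∞) (x : Vertex) : Prop := ∀ l, ((x l).natAbs : ℕ∞) ≤ j

/-- The vertices of `Λ_j` on the boundary of the cube `[-j, j]⁴` (none if `j = ⊤`). -/
def boundaryVertices (j : ℕ∞) : Set Vertex :=
  {x | InBox j x ∧ ∃ l, ((x l).natAbs : ℕ∞) = j}

/-- The positively oriented edges of `Λ_j`: the edge `(e_dir)_base` from `base` to
`base + e_dir`. -/
@[ext] structure Edge (j : ℕ∞) where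
  base : Vertex
  dir : Fin 4
  base_mem : InBox j base
  end_mem : InBox j (base + unitVec dir)

/-- The edge is contained in the boundary of the cube `[-j, j]⁴`, that is, in one of the facets
`x_l = ± j`; then `l ≠ dir`, because `x_dir` is not constant on the edge. -/
def Edge.IsBoundary {j : ℕ∞} (e : Edge j) : Prop :=
  ∃ l, l ≠ e.dir ∧ ((e.base l).natAbs : ℕ∞) = j

/-- The positively oriented `2`-cells of `Λ_j`: the unit square `(e_dir₁ ∧ e_dir₂)_base`
with `dir₁ < dir₂`. -/
@[ext] structure Plaquette (j : ℕ∞) where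
  base : Vertex
  dir₁ : Fin 4
  dir₂ : Fin 4
  dir_lt : dir₁ < dir₂
  base_mem : InBox j base
  corner₁_mem : InBox j (base + unitVec dir₁)
  corner₂_mem : InBox j (base + unitVec dir₂)
  corner₁₂_mem : InBox j (base + unitVec dir₁ + unitVec dir₂)

namespace Plaquette

variable {j : ℕ∞}

/-- The four corners of a `2`-cell. -/
def corners (p : Plaquette j) : Set Vertex :=
  {p.base, p.base + unitVec p.dir₁, p.base + unitVec p.dir₂,
    p.base + unitVec p.dir₁ + unitVec p.dir₂}

/-- The edge `(e_dir₁)_base`. -/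
def edge₁ (p : Plaquette j) : Edge j := ⟨p.base, p.dir₁, p.base_mem, p.corner₁_mem⟩

/-- The edge `(e_dir₂)_base`. -/
def edge₂ (p : Plaquette j) : Edge j := ⟨p.base, p.dir₂, p.base_mem, p.corner₂_mem⟩

/-- The edge `(e_dir₁)_(base + e_dir₂)`. -/
def edge₁' (p : Plaquette j) : Edge j :=
  ⟨p.base + unitVec p.dir₂, p.dir₁, p.corner₂_mem, by
    have h := p.corner₁₂_mem
    rwa [add_right_comm] at h⟩

/-- The edge `(e_dir₂)_(base + e_dir₁)`. -/
def edge₂' (p : Plaquette j) : Edge j :=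
  ⟨p.base + unitVec p.dir₁, p.dir₂, p.corner₁_mem, p.corner₁₂_mem⟩

end Plaquette

/-- The two boundary conditions. -/
inductive BoundaryCondition where
  | free
  | zero

/-- The exterior derivative of a `1`-form: `(dθ)(p)` is the sum of `θ` over the four oriented
edges of `∂p = (e_dir₁)_x + (e_dir₂)_(x + e_dir₁) - (e_dir₁)_(x + e_dir₂) - (e_dir₂)_x`. -/
def extDeriv {j : ℕ∞} (θ : Edge j → ℝ) (p : Plaquette j) : ℝ :=
  θ p.edge₁ + θ p.edge₂' - θ p.edge₁' - θ p.edge₂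

/-- `OneForm bc j θ`: the function `θ` is a `1`-form on `Λ_j` with the given boundary condition.
With the free boundary condition all `1`-forms are allowed; with the zero boundary condition
`θ` has to vanish on the edges contained in the boundary of the cube. -/
def OneForm (bc : BoundaryCondition) (j : ℕ∞) (θ : Edge j → ℝ) : Prop :=
  match bc with
  | .free => True
  | .zero => ∀ e, e.IsBoundary → θ e = 0

/-- The square-summable `2`-forms on `Λ_j`, with the inner product `∑_p f p * g p` over the
positively oriented `2`-cells. If `j` is finite, these are all `2`-forms on `Λ_j`. -/
abbrev TwoForm (j : ℕ∞) : Type := lp (fun _ : Plaquette j => ℝ) 2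

/-- The space `Ω^{1→2}` of all square-summable `2`-forms `dθ`, where `θ` runs through the
`1`-forms with the given boundary condition (`θ` itself need not be square-summable). -/
def exactForms (bc : BoundaryCondition) (j : ℕ∞) : Submodule ℝ (TwoForm j) where
  carrier := {f | ∃ θ : Edge j → ℝ, OneForm bc j θ ∧ ∀ p, f p = extDeriv θ p}
  add_mem' := by
    rintro f g ⟨θ, hθ, hf⟩ ⟨η, hη, hg⟩
    refine ⟨θ + η, ?_, fun p => ?_⟩
    · cases bc
      · trivial
      · intro e he
        simp [hθ e he, hη e he]
    · simp only [lp.coeFn_add, Pi.add_apply, hf, hg, extDeriv]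
      ring
  zero_mem' := by
    refine ⟨0, ?_, fun p => ?_⟩
    · cases bc
      · trivial
      · intro e _
        rfl
    · simp [extDeriv]
  smul_mem' := by
    rintro c f ⟨θ, hθ, hf⟩
    refine ⟨c • θ, ?_, fun p => ?_⟩
    · cases bc
      · trivial
      · intro e he
        simp [hθ e he]
    · simp only [lp.coeFn_smul, Pi.smul_apply, hf, extDeriv, smul_eq_mul]
      ring

section Closed

open Classical in
/-- The chain of an edge, with the boundary edges removed for the zero boundary condition. -/
noncomputable def edgeChain (bc : BoundaryCondition) {j : ℕ∞} (e : Edge j) : Edge j →₀ ℝ :=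
  match bc with
  | .free => Finsupp.single e 1
  | .zero => if e.IsBoundary then 0 else Finsupp.single e 1

/-- The boundary operator on finite `2`-chains; `extDeriv` is its transpose. -/
noncomputable def chainBoundary (bc : BoundaryCondition) (j : ℕ∞) :
    (Plaquette j →₀ ℝ) →ₗ[ℝ] (Edge j →₀ ℝ) :=
  Finsupp.linearCombination ℝ fun p =>
    edgeChain bc p.edge₁ + edgeChain bc p.edge₂' - edgeChain bc p.edge₁' - edgeChain bc p.edge₂

/-- A linear functional on `1`-chains gives a `1`-form with the same boundary condition. -/
theorem oneForm_of_functional (bc : BoundaryCondition) {j : ℕ∞} (φ : (Edge j →₀ ℝ) →ₗ[ℝ] ℝ) :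
    OneForm bc j fun e => φ (edgeChain bc e) := by
  cases bc
  · trivial
  · intro e he
    simp [edgeChain, he]

theorem linearCombination_edgeChain (bc : BoundaryCondition) {j : ℕ∞} {θ : Edge j → ℝ}
    (hθ : OneForm bc j θ) (e : Edge j) :
    Finsupp.linearCombination ℝ θ (edgeChain bc e) = θ e := by
  cases bc
  · simp [edgeChain]
  · by_cases he : e.IsBoundary
    · simp [edgeChain, he, hθ e he]
    · simp [edgeChain, he]

/-- A `2`-form is exact if and only if it annihilates the finite `2`-cycles. -/
theorem mem_exactForms_iff (bc : BoundaryCondition) {j : ℕ∞} (f : TwoForm j) :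
    f ∈ exactForms bc j ↔
      ∀ c ∈ LinearMap.ker (chainBoundary bc j), Finsupp.linearCombination ℝ (⇑f) c = 0 := by
  constructor
  · rintro ⟨θ, hθ, hf⟩ c hc
    have key : Finsupp.linearCombination ℝ (⇑f) =
        (Finsupp.linearCombination ℝ θ).comp (chainBoundary bc j) := by
      ext p
      simp [chainBoundary, hf, extDeriv, linearCombination_edgeChain bc hθ]
    rw [key, LinearMap.comp_apply, LinearMap.mem_ker.mp hc, map_zero]
  · intro h
    have hmem : Finsupp.linearCombination ℝ (⇑f) ∈
        (LinearMap.ker (chainBoundary bc j)).dualAnnihilator :=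
      (Submodule.mem_dualAnnihilator _).mpr h
    rw [← LinearMap.range_dualMap_eq_dualAnnihilator_ker] at hmem
    obtain ⟨φ, hφ⟩ := hmem
    refine ⟨fun e => φ (edgeChain bc e), oneForm_of_functional bc φ, fun p => ?_⟩
    have := LinearMap.congr_fun hφ (Finsupp.single p 1)
    simp only [LinearMap.dualMap_apply, chainBoundary, Finsupp.linearCombination_single,
      one_smul, map_add, map_sub] at this
    exact this.symm

theorem isClosed_exactForms (bc : BoundaryCondition) (j : ℕ∞) :
    IsClosed (exactForms bc j : Set (TwoForm j)) := by
  have h : (exactForms bc j : Set (TwoForm j)) =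
      ⋂ c ∈ LinearMap.ker (chainBoundary bc j),
        {f : TwoForm j | Finsupp.linearCombination ℝ (⇑f) c = 0} := by
    ext f
    simp only [SetLike.mem_coe, mem_exactForms_iff, Set.mem_iInter, Set.mem_ofPred_eq]
  rw [h]
  refine isClosed_biInter fun c _ => isClosed_eq ?_ continuous_const
  simp only [Finsupp.linearCombination_apply, Finsupp.sum]
  exact continuous_finsetSum _ fun p _ =>
    ((lp.lipschitzWith_one_eval 2 p).continuous).const_smul (c p)

/-- `Ω^{1→2}` is a closed subspace of a Hilbert space, so it has an orthogonal projection. -/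
instance (bc : BoundaryCondition) (j : ℕ∞) : (exactForms bc j).HasOrthogonalProjection :=
  haveI : CompleteSpace (exactForms bc j) := (isClosed_exactForms bc j).completeSpace_coe
  inferInstance

end Closed

/-- The orthogonal projection `P_{1→2}` onto `Ω^{1→2}`. For the zero boundary condition,
`Ω^{1→2}` is contained in the space of `2`-forms that vanish on the boundary `2`-cells, and on
that space this is the orthogonal projection within it. -/
noncomputable def proj₁₂ (bc : BoundaryCondition) (j : ℕ∞) : TwoForm j →L[ℝ] TwoForm j :=
  (exactForms bc j).starProjection

/-- A rectangle in `ℤ⁴` parallel to the plane of two coordinate axes: its smallest corner, the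
direction of the side of length `L = length`, and the direction of the side of length
`H = height`. -/
structure Rectangle where
  corner : Vertex
  dirL : Fin 4
  dirH : Fin 4
  dir_ne : dirL ≠ dirH
  length : ℕ
  height : ℕ

namespace Rectangle

/-- The lattice points of the rectangle (inside or on its boundary loop). -/
def vertices (R : Rectangle) : Set Vertex :=
  {x | ∃ s t : ℕ, s ≤ R.length ∧ t ≤ R.height ∧
    x = R.corner + s • unitVec R.dirL + t • unitVec R.dirH}

/-- The distance between the rectangle `R` and the boundary of `Λ_j` is bigger than `M` (this
holds by convention if `j = ⊤`). The distance `dist` on `ℤ⁴` is that of the sup norm; for a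
rectangle contained in the cube its distance to the boundary of the cube is the same for all
`ℓ^p` norms, because a nearest boundary point differs in one coordinate only. -/
def FarFromBoundary (R : Rectangle) (j : ℕ∞) (M : ℝ) : Prop :=
  ∀ x ∈ R.vertices, ∀ y ∈ boundaryVertices j, M < dist x y

theorem vertices_finite (R : Rectangle) : R.vertices.Finite := by
  refine (((Set.finite_Iic R.length).prod (Set.finite_Iic R.height)).image
    fun q : ℕ × ℕ => R.corner + q.1 • unitVec R.dirL + q.2 • unitVec R.dirH).subset ?_
  rintro x ⟨s, t, hs, ht, rfl⟩
  exact ⟨(s, t), ⟨hs, ht⟩, rfl⟩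

/-- The `2`-cells of `Λ_j` contained in the rectangle. -/
def cells (R : Rectangle) (j : ℕ∞) : Set (Plaquette j) := {p | p.corners ⊆ R.vertices}

theorem cells_finite (R : Rectangle) (j : ℕ∞) : (R.cells j).Finite := by
  have hinj : Function.Injective
      fun p : Plaquette j => ((p.base, p.dir₁, p.dir₂) : Vertex × Fin 4 × Fin 4) := by
    intro p q h
    simp only [Prod.mk.injEq] at h
    exact Plaquette.ext h.1 h.2.1 h.2.2
  refine ((R.vertices_finite.prod (Set.finite_univ (α := Fin 4 × Fin 4))).preimage
    hinj.injOn).subset ?_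
  intro p hp
  exact ⟨hp (Or.inl rfl), trivial⟩

open Classical in
/-- The `2`-form `1_R`: it equals `1` on the positively oriented `2`-cells contained in `R`
(and `-1` on their inverses), and `0` on the other `2`-cells. -/
noncomputable def indicatorForm (R : Rectangle) (j : ℕ∞) : TwoForm j :=
  ⟨fun p => if p ∈ R.cells j then 1 else 0, by
    refine (memℓp_zero ((R.cells_finite j).subset ?_)).of_exponent_ge zero_le
    intro p hp
    by_contra h
    exact hp (if_neg h)⟩

end Rectangle

open Classical in
/-- The part `f 1_{|f| < b}` of a `2`-form `f`. -/
noncomputable def smallPart {j : ℕ∞} (b : ℝ) (f : TwoForm j) : TwoForm j :=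
  ⟨fun p => if |f p| < b then f p else 0, by
    refine Memℓp.mono (g := fun p => ‖f p‖) ((memℓp_norm_iff).mpr (lp.memℓp f)) fun p => ?_
    split_ifs
    · exact le_rfl
    · simp⟩

end LatticeGauge

/-! Let `f` be the projection of the indicator form of `R`. It is exact, and it has the same inner
product as `1_R` with every exact form. In particular `‖f‖²` is, up to orientation, the flux of `f`
through `R`. Test forms supported near `R` vanish on the boundary of the cube, so both boundary
conditions give the same local facts, collected in `IsLocalProjection`.

Upper bound: `‖f‖²` is at most a constant times `L + H`. By Stokes, moving `R` changes the flux only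
by the flux through the walls swept by its sides. Averaging over cubes of translations of sides 1,
2, 4, ... up to about `L`, Cauchy–Schwarz makes the changes decay geometrically, and the last
average is bounded directly. So the squared flux is at most a constant times `(L + H) ‖f‖²`
(`sq_rectSum_le`). As the flux is `± ‖f‖²`, one factor cancels (`norm_sq_le`).

Lower bound for the small part: the coclosed difference `f - 1_R` forces a unit of flux of `f`
through each of `n` concentric shells around each edge of the longer side, of length `A`. This gives
`A n` disjoint sets of bounded size, each with total `|f|` at least 1. The sets containing a value
at least `b` number at most `16 ‖f‖² / b²`, which is `O(A / b²)` with a constant independent of `n`.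
For `n` large at least `A` sets remain on which `f` is small, and each adds a fixed amount to the
small part (`card_le_of_disjoint`, `height_mul_le`).

These shells need both sides to be at least `2 n`. Otherwise the bounds on the shape make both sides
at most `(2 n)²`, so `‖f‖²` is bounded, and it suffices to find one shell with small values. Shells
around the whole rectangle are used: closedness and the equation for `f` together show that each of
them detects the magnetic moment `± L H` (`count_le_of_small`). -/

namespace LatticeGauge

/-! ### Discrete Stokes theorem for rectangles -/

/-- The exterior derivative of a `1`-form on `ℤ⁴` given by its four components, as an antisymmetric
matrix of functions. -/
def curl (Θ : Fin 4 → Vertex → ℝ) (a b : Fin 4) (x : Vertex) : ℝ :=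
  Θ a x + Θ b (x + unitVec a) - Θ a (x + unitVec b) - Θ b x

theorem curl_swap (Θ : Fin 4 → Vertex → ℝ) (a b : Fin 4) (x : Vertex) :
    curl Θ b a x = -curl Θ a b x := by
  unfold curl; ring

theorem curl_self (Θ : Fin 4 → Vertex → ℝ) (a : Fin 4) (x : Vertex) : curl Θ a a x = 0 := by
  unfold curl; ring

/-- The second exterior derivative vanishes. -/
theorem curl_closed (Θ : Fin 4 → Vertex → ℝ) (a b k : Fin 4) (x : Vertex) :
    curl Θ a b (x + unitVec k) - curl Θ a b x =
      (curl Θ k b (x + unitVec a) - curl Θ k b x) +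
        (curl Θ a k (x + unitVec b) - curl Θ a k x) := by
  unfold curl
  rw [add_right_comm x (unitVec k) (unitVec a), add_right_comm x (unitVec k) (unitVec b),
    add_right_comm x (unitVec b) (unitVec a)]
  ring

/-- The sum of the component `F a b` over the `L × H` rectangle with corner `w`. -/
def rectSum (F : Fin 4 → Fin 4 → Vertex → ℝ) (a b : Fin 4) (L H : ℕ) (w : Vertex) : ℝ :=
  ∑ s ∈ Finset.range L, ∑ t ∈ Finset.range H, F a b (w + s • unitVec a + t • unitVec b)

/-- Stokes' theorem for the box swept by a rectangle moving by one unit. -/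
theorem rectSum_add_unitVec_sub (Θ : Fin 4 → Vertex → ℝ) (a b k : Fin 4) (L H : ℕ)
    (w : Vertex) :
    rectSum (curl Θ) a b L H (w + unitVec k) - rectSum (curl Θ) a b L H w =
      (∑ t ∈ Finset.range H, curl Θ k b (w + L • unitVec a + t • unitVec b) -
        ∑ t ∈ Finset.range H, curl Θ k b (w + t • unitVec b)) +
      (∑ s ∈ Finset.range L, curl Θ a k (w + H • unitVec b + s • unitVec a) -
        ∑ s ∈ Finset.range L, curl Θ a k (w + s • unitVec a)) := by
  -- Closedness on each unit cube; the first bracket telescopes in `s`, the second in `t`.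
  have key : ∀ s t : ℕ,
      curl Θ a b (w + unitVec k + s • unitVec a + t • unitVec b) -
        curl Θ a b (w + s • unitVec a + t • unitVec b) =
      (curl Θ k b (w + (s + 1) • unitVec a + t • unitVec b) -
        curl Θ k b (w + s • unitVec a + t • unitVec b)) +
      (curl Θ a k (w + s • unitVec a + (t + 1) • unitVec b) -
        curl Θ a k (w + s • unitVec a + t • unitVec b)) := by
    intro s t
    have := curl_closed Θ a b k (w + s • unitVec a + t • unitVec b)
    rw [show w + unitVec k + s • unitVec a + t • unitVec b =
        w + s • unitVec a + t • unitVec b + unitVec k by abel,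
      show w + (s + 1) • unitVec a + t • unitVec b =
        w + s • unitVec a + t • unitVec b + unitVec a by rw [add_smul, one_smul]; abel,
      show w + s • unitVec a + (t + 1) • unitVec b =
        w + s • unitVec a + t • unitVec b + unitVec b by rw [add_smul, one_smul]; abel]
    exact this
  unfold rectSum
  simp only [← Finset.sum_sub_distrib, key, Finset.sum_add_distrib]
  congr 1
  · rw [Finset.sum_comm]
    refine Finset.sum_congr rfl fun t _ => ?_
    rw [Finset.sum_range_sub (fun s => curl Θ k b (w + s • unitVec a + t • unitVec b))]
    simp
  · refine Finset.sum_congr rfl fun s _ => ?_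
    rw [Finset.sum_range_sub (fun t => curl Θ a k (w + s • unitVec a + t • unitVec b))]
    rw [add_right_comm w (H • unitVec b)]
    simp

/-! ### Cauchy–Schwarz for sums over cubes of translations -/

/-- Cauchy–Schwarz for a sum of values of `G` along a map `φ` that is injective on the fibres of
a label `g`. -/
theorem sq_sum_comp_le {ι κ α : Type*} [DecidableEq κ] [DecidableEq α] (I : Finset ι)
    (J : Finset κ) (g : ι → κ) (φ : ι → α) (G : α → ℝ) (N : ℝ) (hg : ∀ i ∈ I, g i ∈ J)
    (hinj : ∀ i ∈ I, ∀ i' ∈ I, g i = g i' → φ i = φ i' → i = i')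
    (hN : ∀ S : Finset α, (∀ x ∈ S, ∃ i ∈ I, φ i = x) → ∑ x ∈ S, G x ^ 2 ≤ N) :
    (∑ i ∈ I, G (φ i)) ^ 2 ≤ (I.card : ℝ) * J.card * N := by
  have h1 : (∑ i ∈ I, G (φ i)) ^ 2 ≤ I.card * ∑ i ∈ I, G (φ i) ^ 2 := sq_sum_le_card_mul_sum_sq
  -- No point is hit twice within one fibre of `g`, so each of the `J.card` fibres contributes at
  -- most `N`.
  have h2 : ∑ i ∈ I, G (φ i) ^ 2 ≤ J.card * N := by
    rw [← Finset.sum_fiberwise_of_maps_to hg, ← nsmul_eq_mul]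
    refine Finset.sum_le_card_nsmul _ _ _ fun c _ => ?_
    rw [← Finset.sum_image (f := fun x => G x ^ 2) (g := φ)]
    · refine hN _ fun x hx => ?_
      obtain ⟨i, hi, rfl⟩ := Finset.mem_image.mp hx
      exact ⟨i, (Finset.mem_filter.mp hi).1, rfl⟩
    · intro i hi i' hi' h
      simp only [Finset.coe_filter, Set.mem_ofPred_eq] at hi hi'
      exact hinj i hi.1 i' hi'.1 (hi.2.trans hi'.2.symm) h
  calc _ ≤ _ := h1
    _ ≤ I.card * (J.card * N) := by gcongr
    _ = _ := by ring

/-- The lattice vector with coordinates `w l`. -/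
def cubeVec {m : ℕ} (w : Fin 4 → Fin m) : Vertex := fun l => ((w l : ℕ) : ℤ)

theorem nsmul_unitVec_apply (n : ℕ) (a l : Fin 4) :
    (n • unitVec a) l = if l = a then (n : ℤ) else 0 := by
  simp [unitVec, Pi.single_apply]

theorem unitVec_apply (a l : Fin 4) : unitVec a l = if l = a then (1 : ℤ) else 0 := by
  simp [unitVec, Pi.single_apply]

/-- The sum over a cube of translations of the walls swept by a side of length `n`. -/
theorem sq_sum_wall_le (G : Vertex → ℝ) (N : ℝ) (m n : ℕ) (y : Vertex) (k b : Fin 4)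
    (hN : ∀ S : Finset Vertex, (∀ x ∈ S, ∃ w : Fin 4 → Fin m, ∃ i < m, ∃ t < n,
      y + cubeVec w + i • unitVec k + t • unitVec b = x) → ∑ x ∈ S, G x ^ 2 ≤ N) :
    (∑ w : Fin 4 → Fin m, ∑ i ∈ Finset.range m, ∑ t ∈ Finset.range n,
      G (y + cubeVec w + i • unitVec k + t • unitVec b)) ^ 2 ≤ (m : ℝ) ^ 7 * n * N := by
  -- Once `w b` and `i` are known, the point determines `t` and then `w`. So there are `m ^ 2`
  -- labels for `m ^ 5 * n` terms.
  have h := sq_sum_comp_le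
    ((Finset.univ : Finset (Fin 4 → Fin m)) ×ˢ Finset.range m ×ˢ Finset.range n)
    ((Finset.univ : Finset (Fin m)) ×ˢ Finset.range m) (fun q => (q.1 b, q.2.1))
    (fun q => y + cubeVec q.1 + q.2.1 • unitVec k + q.2.2 • unitVec b) G N
    (by rintro ⟨w, i, t⟩ hq; simpa using (by simpa using hq : i < m ∧ t < n).1)
    (by
      rintro ⟨w, i, t⟩ - ⟨w', i', t'⟩ - hg hφ
      obtain ⟨hw, rfl⟩ : w b = w' b ∧ i = i' := by simpa using hg
      have hl : ∀ l, ((w l : ℕ) : ℤ) + (if l = b then (t : ℤ) else 0) =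
          ((w' l : ℕ) : ℤ) + (if l = b then (t' : ℤ) else 0) := by
        intro l
        have := congrFun hφ l
        simp only [Pi.add_apply, nsmul_unitVec_apply, cubeVec] at this
        linarith
      have ht : t = t' := by
        have := hl b
        simp only [hw, if_true] at this
        omega
      subst ht
      have : w = w' := by
        funext l
        have := hl l
        apply Fin.ext
        omega
      subst this
      rfl)
    (by
      intro S hS
      refine hN S fun x hx => ?_
      obtain ⟨⟨w, i, t⟩, hq, rfl⟩ := hS x hx
      have hq' : i < m ∧ t < n := by simpa using hq
      exact ⟨w, i, hq'.1, t, hq'.2, rfl⟩)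
  simp only [Finset.sum_product] at h
  refine h.trans (le_of_eq ?_)
  simp only [Finset.card_product, Finset.card_range, Finset.card_univ, Fintype.card_pi,
    Fintype.card_fin, Finset.prod_const]
  push_cast
  ring

/-- The sum over a cube of translations of the rectangle. -/
theorem sq_sum_rect_le (F : Fin 4 → Fin 4 → Vertex → ℝ) (N : ℝ) (m L H : ℕ) (y : Vertex)
    (a b : Fin 4) (hab : a ≠ b)
    (hN : ∀ S : Finset Vertex, (∀ x ∈ S, ∃ w : Fin 4 → Fin m, ∃ s < L, ∃ t < H,
      y + cubeVec w + s • unitVec a + t • unitVec b = x) → ∑ x ∈ S, F a b x ^ 2 ≤ N) :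
    (∑ w : Fin 4 → Fin m, rectSum F a b L H (y + cubeVec w)) ^ 2 ≤
      (m : ℝ) ^ 6 * L * H * N := by
  -- Here `w a` and `w b` are the label: they let the point determine `s` and `t`, hence `w`. This
  -- gives `m ^ 2` labels for `m ^ 4 * L * H` terms.
  have h := sq_sum_comp_le
    ((Finset.univ : Finset (Fin 4 → Fin m)) ×ˢ Finset.range L ×ˢ Finset.range H)
    (Finset.univ : Finset (Fin m × Fin m)) (fun q => (q.1 a, q.1 b))
    (fun q => y + cubeVec q.1 + q.2.1 • unitVec a + q.2.2 • unitVec b) (F a b) N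
    (by simp)
    (by
      rintro ⟨w, s, t⟩ - ⟨w', s', t'⟩ - hg hφ
      obtain ⟨hwa, hwb⟩ : w a = w' a ∧ w b = w' b := by simpa using hg
      have hl : ∀ l, ((w l : ℕ) : ℤ) + (if l = a then (s : ℤ) else 0) +
          (if l = b then (t : ℤ) else 0) =
          ((w' l : ℕ) : ℤ) + (if l = a then (s' : ℤ) else 0) +
          (if l = b then (t' : ℤ) else 0) := by
        intro l
        have := congrFun hφ l
        simp only [Pi.add_apply, nsmul_unitVec_apply, cubeVec] at this
        linarith
      have hs : s = s' := by
        have := hl a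
        simp only [hwa, if_true, if_neg hab] at this
        omega
      have ht : t = t' := by
        have := hl b
        simp only [hwb, if_true, if_neg hab.symm] at this
        omega
      subst ht hs
      have : w = w' := by
        funext l
        have := hl l
        apply Fin.ext
        omega
      subst this
      rfl)
    (by
      intro S hS
      refine hN S fun x hx => ?_
      obtain ⟨⟨w, s, t⟩, hq, rfl⟩ := hS x hx
      have hq' : s < L ∧ t < H := by simpa using hq
      exact ⟨w, s, hq'.1, t, hq'.2, rfl⟩)
  simp only [Finset.sum_product] at h
  refine h.trans (le_of_eq ?_)
  simp only [Finset.card_product, Finset.card_range, Finset.card_univ, Fintype.card_pi,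
    Fintype.card_fin, Finset.prod_const, Fintype.card_prod]
  push_cast
  ring

/-- The cube of side `2 * m` is the union of sixteen cubes of side `m`. -/
theorem sum_cube_two_mul (T : Vertex → ℝ) (m : ℕ) :
    ∑ w : Fin 4 → Fin (2 * m), T (cubeVec w) =
      ∑ ε : Fin 4 → Fin 2, ∑ w : Fin 4 → Fin m, T (m • cubeVec ε + cubeVec w) := by
  rw [← Fintype.sum_prod_type']
  symm
  refine Fintype.sum_equiv
    ((Equiv.arrowProdEquivProdArrow (Fin 4) (fun _ => Fin 2) (fun _ => Fin m)).symm.trans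
      (Equiv.arrowCongr (Equiv.refl _) finProdFinEquiv)) _ _ ?_
  rintro ⟨ε, w⟩
  congr 1
  funext l
  simp [cubeVec, finProdFinEquiv, Equiv.arrowCongr, Equiv.arrowProdEquivProdArrow]
  ring

/-! ### Flux bound by dyadic averaging over translations -/

section Translation

variable {Θ : Fin 4 → Vertex → ℝ} {N : ℝ} {a b : Fin 4} {L H : ℕ} {x₀ : Vertex} {M : ℕ}

/-- Moving a cube average of the rectangle sums by the side of the cube. -/
theorem abs_sum_shift_le
    (hN : ∀ c d, ∀ S : Finset Vertex, (∀ x ∈ S, ∃ v : Vertex, ∃ s ≤ L, ∃ t ≤ H,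
      (∀ l, 0 ≤ v l ∧ v l < M) ∧ x₀ + v + s • unitVec a + t • unitVec b = x) →
      ∑ x ∈ S, curl Θ c d x ^ 2 ≤ N)
    (m : ℕ) (y : Vertex) (k : Fin 4)
    (hy : ∀ l, 0 ≤ y l ∧ y l + m + (if l = k then (m : ℤ) else 0) ≤ M) :
    |∑ w : Fin 4 → Fin m, (rectSum (curl Θ) a b L H (x₀ + (y + m • unitVec k + cubeVec w)) -
      rectSum (curl Θ) a b L H (x₀ + (y + cubeVec w)))| ≤
      4 * √((m : ℝ) ^ 7 * (L + H) * N) := by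
  have hN0 : 0 ≤ N := by simpa using hN a b ∅ (by simp)
  have reg : ∀ (w : Fin 4 → Fin m) (i : ℕ), i < m →
      ∀ l, 0 ≤ (y + cubeVec w + i • unitVec k) l ∧ (y + cubeVec w + i • unitVec k) l < M := by
    intro w i hi l
    have h1 := hy l
    have h2 := (w l).isLt
    simp only [Pi.add_apply, nsmul_unitVec_apply, cubeVec]
    split_ifs at h1 ⊢ <;> omega
  have wallH : ∀ r ≤ L, |∑ w : Fin 4 → Fin m, ∑ i ∈ Finset.range m, ∑ t ∈ Finset.range H,
      curl Θ k b (x₀ + y + r • unitVec a + cubeVec w + i • unitVec k + t • unitVec b)| ≤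
      √((m : ℝ) ^ 7 * (L + H) * N) := by
    intro r hr
    refine Real.abs_le_sqrt ((sq_sum_wall_le (curl Θ k b) N m H _ k b fun S hS => hN k b S ?_).trans
      ?_)
    · intro x hx
      obtain ⟨w, i, hi, t, ht, rfl⟩ := hS x hx
      exact ⟨_, r, hr, t, ht.le, reg w i hi, by abel⟩
    · gcongr
      simp
  have wallL : ∀ r ≤ H, |∑ w : Fin 4 → Fin m, ∑ i ∈ Finset.range m, ∑ s ∈ Finset.range L,
      curl Θ a k (x₀ + y + r • unitVec b + cubeVec w + i • unitVec k + s • unitVec a)| ≤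
      √((m : ℝ) ^ 7 * (L + H) * N) := by
    intro r hr
    refine Real.abs_le_sqrt ((sq_sum_wall_le (curl Θ a k) N m L _ k a fun S hS => hN a k S ?_).trans
      ?_)
    · intro x hx
      obtain ⟨w, i, hi, s, hs, rfl⟩ := hS x hx
      exact ⟨_, s, hs.le, r, hr, reg w i hi, by abel⟩
    · gcongr
      simp
  -- The translation by `m` is made in unit steps, and Stokes is applied to each. The four sides of
  -- the rectangle sweep four walls, whence the factor 4.
  have e1 : ∀ w : Fin 4 → Fin m,
      rectSum (curl Θ) a b L H (x₀ + (y + m • unitVec k + cubeVec w)) -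
        rectSum (curl Θ) a b L H (x₀ + (y + cubeVec w)) =
      ∑ i ∈ Finset.range m,
        ((∑ t ∈ Finset.range H,
          curl Θ k b (x₀ + y + L • unitVec a + cubeVec w + i • unitVec k + t • unitVec b) -
        ∑ t ∈ Finset.range H,
          curl Θ k b (x₀ + y + 0 • unitVec a + cubeVec w + i • unitVec k + t • unitVec b)) +
        (∑ s ∈ Finset.range L,
          curl Θ a k (x₀ + y + H • unitVec b + cubeVec w + i • unitVec k + s • unitVec a) -
        ∑ s ∈ Finset.range L,
          curl Θ a k (x₀ + y + 0 • unitVec b + cubeVec w + i • unitVec k + s • unitVec a))) := by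
    intro w
    have := Finset.sum_range_sub
      (fun i => rectSum (curl Θ) a b L H (x₀ + y + cubeVec w + i • unitVec k)) m
    rw [show x₀ + (y + m • unitVec k + cubeVec w) = x₀ + y + cubeVec w + m • unitVec k by abel,
      show x₀ + (y + cubeVec w) = x₀ + y + cubeVec w + 0 • unitVec k by rw [zero_smul]; abel]
    rw [← this]
    refine Finset.sum_congr rfl fun i _ => ?_
    rw [show x₀ + y + cubeVec w + (i + 1) • unitVec k =
      x₀ + y + cubeVec w + i • unitVec k + unitVec k by rw [add_smul, one_smul]; abel,
      rectSum_add_unitVec_sub]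
    simp only [zero_smul, add_zero]
    congr 2
    · refine Finset.sum_congr rfl fun t _ => ?_
      congr 1; abel
    · refine Finset.sum_congr rfl fun t _ => ?_
      congr 1; abel
  simp only [e1, Finset.sum_add_distrib, Finset.sum_sub_distrib]
  have h1 := abs_le.mp (wallH L le_rfl)
  have h2 := abs_le.mp (wallH 0 (Nat.zero_le _))
  have h3 := abs_le.mp (wallL H le_rfl)
  have h4 := abs_le.mp (wallL 0 (Nat.zero_le _))
  rw [abs_le]
  constructor <;> linarith [h1.1, h1.2, h2.1, h2.2, h3.1, h3.2, h4.1, h4.2]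

/-- The difference of the averages over cubes of sides `2 * m` and `m`. -/
theorem abs_average_double_sub_le
    (hN : ∀ c d, ∀ S : Finset Vertex, (∀ x ∈ S, ∃ v : Vertex, ∃ s ≤ L, ∃ t ≤ H,
      (∀ l, 0 ≤ v l ∧ v l < M) ∧ x₀ + v + s • unitVec a + t • unitVec b = x) →
      ∑ x ∈ S, curl Θ c d x ^ 2 ≤ N)
    (m : ℕ) (hm : 0 < m) (hmM : 2 * m ≤ M) :
    |(∑ w : Fin 4 → Fin (2 * m), rectSum (curl Θ) a b L H (x₀ + cubeVec w)) /
        ((2 * m : ℕ) : ℝ) ^ 4 -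
      (∑ w : Fin 4 → Fin m, rectSum (curl Θ) a b L H (x₀ + cubeVec w)) / (m : ℝ) ^ 4| ≤
      16 * √((L + H) * N / m) := by
  have hm' : (0 : ℝ) < m := by exact_mod_cast hm
  have hN0 : 0 ≤ N := by simpa using hN a b ∅ (by simp)
  set X := √((m : ℝ) ^ 7 * (L + H) * N) with hX
  have hXm : X = (m : ℝ) ^ 4 * √((L + H) * N / m) := by
    rw [hX, show (m : ℝ) ^ 7 * (L + H) * N = ((m : ℝ) ^ 4) ^ 2 * ((L + H) * N / m) by
      field_simp, Real.sqrt_mul (by positivity), Real.sqrt_sq (by positivity)]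
  set T : Vertex → ℝ := fun v => rectSum (curl Θ) a b L H (x₀ + v) with hT
  have step : ∀ (e : Fin 2) (y : Vertex) (k : Fin 4), y k = 0 → (∀ l, 0 ≤ y l ∧ y l ≤ m) →
      |∑ w : Fin 4 → Fin m, (T (y + (m * (e : ℕ)) • unitVec k + cubeVec w) -
        T (y + cubeVec w))| ≤ 4 * X := by
    intro e y k hk hy
    fin_cases e
    · simp only [mul_zero, zero_smul, add_zero, sub_self,
        Finset.sum_const_zero, abs_zero]
      positivity
    · simp only [mul_one]
      refine abs_sum_shift_le hN m y k fun l => ?_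
      have := hy l
      split_ifs with h
      · subst h; omega
      · omega
  have corner : ∀ ε : Fin 4 → Fin 2,
      |∑ w : Fin 4 → Fin m, (T (m • cubeVec ε + cubeVec w) - T (cubeVec w))| ≤ 16 * X := by
    intro ε
    have hε : ∀ l, (ε l : ℕ) ≤ 1 := fun l => by omega
    have hmε : ∀ l, m * (ε l : ℕ) ≤ m := fun l => by nlinarith [hε l]
    -- Each subcube is reached from the one at the origin by moving along one coordinate at a time:
    -- four moves of cost at most `4 * X`.
    set y₁ : Vertex := 0 + (m * (ε 0 : ℕ)) • unitVec 0 with h₁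
    set y₂ : Vertex := y₁ + (m * (ε 1 : ℕ)) • unitVec 1 with h₂
    set y₃ : Vertex := y₂ + (m * (ε 2 : ℕ)) • unitVec 2 with h₃
    have h₄ : m • cubeVec ε = y₃ + (m * (ε 3 : ℕ)) • unitVec 3 := by
      funext l
      simp only [h₁, h₂, h₃, Pi.add_apply, unitVec_apply, Pi.smul_apply, cubeVec]
      fin_cases l <;> simp
    have s₀ := step (ε 0) 0 0 rfl (fun l => by simp)
    have s₁ := step (ε 1) y₁ 1 (by simp [h₁, unitVec_apply]) (fun l => by
      have := hmε 0
      simp only [h₁, Pi.add_apply, nsmul_unitVec_apply]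
      fin_cases l <;> simp <;> norm_cast <;> omega)
    have s₂ := step (ε 2) y₂ 2 (by simp [h₁, h₂, unitVec_apply]) (fun l => by
      have := hmε 0
      have := hmε 1
      simp only [h₁, h₂, Pi.add_apply, nsmul_unitVec_apply]
      fin_cases l <;> simp <;> norm_cast <;> omega)
    have s₃ := step (ε 3) y₃ 3 (by simp [h₁, h₂, h₃, unitVec_apply]) (fun l => by
      have := hmε 0
      have := hmε 1
      have := hmε 2
      simp only [h₁, h₂, h₃, Pi.add_apply, nsmul_unitVec_apply]
      fin_cases l <;> simp <;> norm_cast <;> omega)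
    rw [← h₁] at s₀
    rw [← h₂] at s₁
    rw [← h₃] at s₂
    rw [← h₄] at s₃
    simp only [zero_add] at s₀
    simp only [Finset.sum_sub_distrib] at s₀ s₁ s₂ s₃ ⊢
    rw [abs_le] at s₀ s₁ s₂ s₃ ⊢
    constructor <;> linarith [s₀.1, s₀.2, s₁.1, s₁.2, s₂.1, s₂.2, s₃.1, s₃.2]
  have total : |∑ w : Fin 4 → Fin (2 * m), T (cubeVec w) - 16 * ∑ w : Fin 4 → Fin m, T (cubeVec w)|
      ≤ 16 * (16 * X) := by
    have : ∑ w : Fin 4 → Fin (2 * m), T (cubeVec w) - 16 * ∑ w : Fin 4 → Fin m, T (cubeVec w) =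
        ∑ ε : Fin 4 → Fin 2, ∑ w : Fin 4 → Fin m, (T (m • cubeVec ε + cubeVec w) - T (cubeVec w)) := by
      rw [sum_cube_two_mul]
      simp only [Finset.sum_sub_distrib]
      simp
    rw [this]
    refine (Finset.abs_sum_le_sum_abs _ _).trans
      ((Finset.sum_le_card_nsmul _ _ _ fun ε _ => corner ε).trans ?_)
    simp
  have : (∑ w : Fin 4 → Fin (2 * m), T (cubeVec w)) / ((2 * m : ℕ) : ℝ) ^ 4 -
      (∑ w : Fin 4 → Fin m, T (cubeVec w)) / (m : ℝ) ^ 4 =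
      (∑ w : Fin 4 → Fin (2 * m), T (cubeVec w) - 16 * ∑ w : Fin 4 → Fin m, T (cubeVec w)) /
        (16 * (m : ℝ) ^ 4) := by
    push_cast
    field_simp
    ring
  change |(∑ w : Fin 4 → Fin (2 * m), T (cubeVec w)) / ((2 * m : ℕ) : ℝ) ^ 4 -
      (∑ w : Fin 4 → Fin m, T (cubeVec w)) / (m : ℝ) ^ 4| ≤ _
  rw [this, abs_div, abs_of_pos (by positivity : (0 : ℝ) < 16 * (m : ℝ) ^ 4),
    div_le_iff₀ (by positivity)]
  refine total.trans (le_of_eq ?_)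
  rw [hXm]
  ring

/-- The flux of an exact form through a rectangle is at most a constant times the square root of
the perimeter times the norm of the form near the rectangle. -/
theorem sq_rectSum_le (hab : a ≠ b) (hL : 0 < L) (hLM : L ≤ M)
    (hN : ∀ c d, ∀ S : Finset Vertex, (∀ x ∈ S, ∃ v : Vertex, ∃ s ≤ L, ∃ t ≤ H,
      (∀ l, 0 ≤ v l ∧ v l < M) ∧ x₀ + v + s • unitVec a + t • unitVec b = x) →
      ∑ x ∈ S, curl Θ c d x ^ 2 ≤ N) :
    rectSum (curl Θ) a b L H x₀ ^ 2 ≤ 66 ^ 2 * (L + H) * N := by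
  have hN0 : 0 ≤ N := by simpa using hN a b ∅ (by simp)
  set A : ℕ → ℝ := fun n =>
    (∑ w : Fin 4 → Fin (2 ^ n), rectSum (curl Θ) a b L H (x₀ + cubeVec w)) /
      ((2 ^ n : ℕ) : ℝ) ^ 4 with hA
  set X := √((L + H) * N) with hX
  have hX0 : 0 ≤ X := Real.sqrt_nonneg _
  have hA0 : A 0 = rectSum (curl Θ) a b L H x₀ := by
    have h0 : ∀ w : Fin 4 → Fin (2 ^ 0), cubeVec w = 0 := by
      intro w; funext l
      have := (w l).isLt
      simp only [pow_zero] at this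
      simp only [cubeVec, Pi.zero_apply]
      omega
    simp [hA, h0]
  -- The decay `2 ^ (-n / 2)` is replaced by the larger `(3 / 4) ^ n`, so that the geometric series
  -- has sum 64.
  have hdiff : ∀ n, 2 ^ (n + 1) ≤ M → |A (n + 1) - A n| ≤ 16 * X * (3 / 4) ^ n := by
    intro n hn
    have h := abs_average_double_sub_le hN (2 ^ n) (by positivity) (by rw [← pow_succ']; exact hn)
    simp only [hA]
    rw [show (2 : ℕ) ^ (n + 1) = 2 * 2 ^ n from pow_succ' 2 n]
    refine h.trans ?_
    rw [mul_assoc]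
    gcongr
    rw [Real.sqrt_le_left (by positivity)]
    rw [mul_pow, Real.sq_sqrt (by positivity), div_eq_mul_inv]
    gcongr
    rw [← pow_mul, mul_comm n 2, pow_mul]
    push_cast
    rw [← inv_pow]
    gcongr
    norm_num
  have hsum : ∀ n, 2 ^ n ≤ M → |A n - A 0| ≤ 64 * X * (1 - (3 / 4) ^ n) := by
    intro n
    induction n with
    | zero => simp
    | succ n ih =>
      intro hn
      have h1 := ih (le_trans (Nat.pow_le_pow_right (by norm_num) n.le_succ) hn)
      have h2 := hdiff n hn
      calc |A (n + 1) - A 0| ≤ |A (n + 1) - A n| + |A n - A 0| := abs_sub_le _ _ _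
        _ ≤ _ := add_le_add h2 h1
        _ = _ := by rw [pow_succ]; ring
  set n := Nat.log 2 L with hn
  have hnL : 2 ^ n ≤ L := Nat.pow_log_le_self 2 hL.ne'
  have hnL' : L < 2 ^ (n + 1) := Nat.lt_pow_succ_log_self (by norm_num) L
  -- At side `m = 2 ^ n` the squared average is at most `L * H * N / m ^ 2`, and `L ≤ 2 * m ≤ 4 * m
  -- ^ 2`.
  have hAn : |A n| ≤ 2 * X := by
    have h := sq_sum_rect_le (curl Θ) N (2 ^ n) L H x₀ a b hab (fun S hS => hN a b S fun x hx => by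
      obtain ⟨w, s, hs, t, ht, rfl⟩ := hS x hx
      refine ⟨cubeVec w, s, hs.le, t, ht.le, fun l => ?_, rfl⟩
      have := (w l).isLt
      have h3 : (w l : ℕ) < M := by omega
      simp only [cubeVec]
      exact ⟨by positivity, by exact_mod_cast h3⟩)
    rw [← abs_of_nonneg (by positivity : 0 ≤ 2 * X), ← sq_le_sq, mul_pow, hX,
      Real.sq_sqrt (by positivity)]
    simp only [hA]
    rw [div_pow, div_le_iff₀ (by positivity)]
    refine h.trans ?_
    set m := 2 ^ n with hm
    have hm1 : 1 ≤ m := Nat.one_le_two_pow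
    have hLm : (L : ℝ) ≤ 2 * m := by
      have : L ≤ 2 * m := by rw [hm, ← pow_succ']; exact hnL'.le
      exact_mod_cast this
    have hm1' : (1 : ℝ) ≤ m := by exact_mod_cast hm1
    have hLm2 : (L : ℝ) ≤ 4 * (m : ℝ) ^ 2 := by nlinarith
    calc (m : ℝ) ^ 6 * L * H * N ≤ (m : ℝ) ^ 6 * (4 * (m : ℝ) ^ 2) * H * N := by gcongr
      _ = 2 ^ 2 * (H * N) * ((m : ℝ) ^ 4) ^ 2 := by ring
      _ ≤ 2 ^ 2 * ((L + H) * N) * ((m : ℝ) ^ 4) ^ 2 := by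
        gcongr
        simp
  clear_value A X n
  have hfin : |A 0| ≤ 66 * X := by
    have h1 := hsum n (hnL.trans hLM)
    have h2 : 64 * X * (1 - (3 / 4) ^ n) ≤ 64 * X := by
      have : (0 : ℝ) ≤ (3 / 4) ^ n := by positivity
      nlinarith
    calc |A 0| = |A n - (A n - A 0)| := by rw [sub_sub_cancel]
      _ ≤ |A n| + |A n - A 0| := abs_sub _ _
      _ ≤ 66 * X := by linarith
  rw [← hA0, ← sq_abs]
  calc |A 0| ^ 2 ≤ (66 * X) ^ 2 := by gcongr
    _ = _ := by rw [mul_pow, hX, Real.sq_sqrt (by positivity)]; ring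

end Translation

/-! ### Neighbourhoods of the rectangle and the local properties of the projection -/

/-- The points at sup-distance at most `M` from the rectangle. -/
def Rectangle.Near (R : Rectangle) (M : ℕ) (x : Vertex) : Prop :=
  ∃ y ∈ R.vertices, ∀ l, |x l - y l| ≤ M

theorem Rectangle.Near.mono {R : Rectangle} {M M' : ℕ} (h : M ≤ M') {x : Vertex}
    (hx : R.Near M x) : R.Near M' x := by
  obtain ⟨y, hy, hxy⟩ := hx
  exact ⟨y, hy, fun l => (hxy l).trans (by exact_mod_cast h)⟩

theorem Rectangle.near_zero_iff {R : Rectangle} {x : Vertex} : R.Near 0 x ↔ x ∈ R.vertices := by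
  constructor
  · rintro ⟨y, hy, h⟩
    have : x = y := funext fun l => by
      have := h l
      rw [Nat.cast_zero, abs_nonpos_iff] at this
      linarith
    exact this ▸ hy
  · exact fun h => ⟨x, h, by simp⟩

theorem Rectangle.Near.add_unitVec {R : Rectangle} {M : ℕ} {x : Vertex}
    (hx : R.Near M x) (c : Fin 4) : R.Near (M + 1) (x + unitVec c) := by
  obtain ⟨y, hy, hxy⟩ := hx
  refine ⟨y, hy, fun l => ?_⟩
  have := abs_le.mp (hxy l)
  simp only [Pi.add_apply, unitVec_apply]
  push_cast
  rw [abs_le]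
  split_ifs <;> constructor <;> linarith [this.1, this.2]

theorem Rectangle.Near.of_add_unitVec {R : Rectangle} {M : ℕ} {x : Vertex} {c : Fin 4}
    (hx : R.Near M (x + unitVec c)) : R.Near (M + 1) x := by
  obtain ⟨y, hy, hxy⟩ := hx
  refine ⟨y, hy, fun l => ?_⟩
  have := abs_le.mp (hxy l)
  simp only [Pi.add_apply, unitVec_apply] at this
  push_cast
  rw [abs_le]
  split_ifs at this <;> constructor <;> linarith [this.1, this.2]

/-- The rectangle with its two sides exchanged. -/
def Rectangle.swap (R : Rectangle) : Rectangle where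
  corner := R.corner
  dirL := R.dirH
  dirH := R.dirL
  dir_ne := R.dir_ne.symm
  length := R.height
  height := R.length

theorem Rectangle.vertices_swap (R : Rectangle) : R.swap.vertices = R.vertices := by
  ext x
  constructor
  · rintro ⟨s, t, hs, ht, rfl⟩
    exact ⟨t, s, ht, hs, add_right_comm _ _ _⟩
  · rintro ⟨s, t, hs, ht, rfl⟩
    exact ⟨t, s, ht, hs, add_right_comm _ _ _⟩

theorem Rectangle.near_swap {R : Rectangle} {M : ℕ} {x : Vertex} :
    R.swap.Near M x ↔ R.Near M x := by
  simp only [Rectangle.Near, Rectangle.vertices_swap]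

/-- `u` if `|u| < b`, and `0` otherwise. -/
noncomputable def smallValue (b u : ℝ) : ℝ := if |u| < b then u else 0

/-- The local properties of the projection of `σ 1_R` near `R`: it is exact with square norm `Nf`,
its small part has square norm `Ns`, and it differs from `σ 1_R` by a coclosed form. -/
structure IsLocalProjection (R : Rectangle) (M : ℕ) (b : ℝ) (Θ : Fin 4 → Vertex → ℝ)
    (σ Nf Ns : ℝ) : Prop where
  sum_sq_le : ∀ c d (S : Finset Vertex), (∀ x ∈ S, R.Near (M + 1) x) →
    ∑ x ∈ S, curl Θ c d x ^ 2 ≤ Nf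
  sum_small_sq_le : ∀ c d (S : Finset Vertex), (∀ x ∈ S, R.Near (M + 1) x) →
    ∑ x ∈ S, smallValue b (curl Θ c d x) ^ 2 ≤ Ns
  abs_sign : |σ| = 1
  flux : σ * rectSum (curl Θ) R.dirL R.dirH R.length R.height R.corner = Nf
  weak : ∀ (k : Fin 4) (h : Vertex → ℝ), (∀ x, h x ≠ 0 → R.Near M x) →
    ∑' x, ∑ c, curl Θ c k x * (h (x + unitVec c) - h x) =
      σ * rectSum (curl (Pi.single k h)) R.dirL R.dirH R.length R.height R.corner

theorem rectSum_curl_swap (Θ : Fin 4 → Vertex → ℝ) (a b : Fin 4) (L H : ℕ) (w : Vertex) :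
    rectSum (curl Θ) b a H L w = -rectSum (curl Θ) a b L H w := by
  unfold rectSum
  rw [Finset.sum_comm]
  simp only [← Finset.sum_neg_distrib]
  refine Finset.sum_congr rfl fun s _ => Finset.sum_congr rfl fun t _ => ?_
  rw [curl_swap, add_right_comm]

/-- Exchanging the sides reverses the orientation of the rectangle, which the sign `σ` absorbs.
Estimates for a side in direction `dirH` thereby apply to the other side as well. -/
theorem IsLocalProjection.swap {R : Rectangle} {M : ℕ} {b : ℝ} {Θ : Fin 4 → Vertex → ℝ}
    {σ Nf Ns : ℝ} (h : IsLocalProjection R M b Θ σ Nf Ns) :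
    IsLocalProjection R.swap M b Θ (-σ) Nf Ns where
  sum_sq_le c d S hS := h.sum_sq_le c d S fun x hx => Rectangle.near_swap.mp (hS x hx)
  sum_small_sq_le c d S hS := h.sum_small_sq_le c d S fun x hx => Rectangle.near_swap.mp (hS x hx)
  abs_sign := by rw [abs_neg, h.abs_sign]
  flux := by
    rw [← h.flux]
    simp only [Rectangle.swap]
    rw [rectSum_curl_swap, neg_mul_neg]
  weak k f hf := by
    rw [h.weak k f fun x hx => Rectangle.near_swap.mp (hf x hx)]
    simp only [Rectangle.swap]
    rw [rectSum_curl_swap _ R.dirL R.dirH, neg_mul_neg]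

/-! ### Many disjoint sets carrying mass force a small part -/

/-- The factor 16 counts the ordered pairs of directions. -/
theorem sum_index_sq_le (F : Fin 4 → Fin 4 → Vertex → ℝ) (N : ℝ) (P : Vertex → Prop)
    (hN : ∀ c d (S : Finset Vertex), (∀ x ∈ S, P x) → ∑ x ∈ S, F c d x ^ 2 ≤ N)
    (U : Finset (Fin 4 × Fin 4 × Vertex)) (hU : ∀ q ∈ U, P q.2.2) :
    ∑ q ∈ U, F q.1 q.2.1 q.2.2 ^ 2 ≤ 16 * N := by
  classical
  have hsub : U ⊆ (Finset.univ : Finset (Fin 4)) ×ˢ (Finset.univ : Finset (Fin 4)) ×ˢ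
      U.image (fun q => q.2.2) := by
    intro q hq
    simp only [Finset.mem_product, Finset.mem_univ, true_and]
    exact Finset.mem_image_of_mem _ hq
  calc ∑ q ∈ U, F q.1 q.2.1 q.2.2 ^ 2
      ≤ ∑ q ∈ (Finset.univ : Finset (Fin 4)) ×ˢ (Finset.univ : Finset (Fin 4)) ×ˢ
        U.image (fun q => q.2.2), F q.1 q.2.1 q.2.2 ^ 2 :=
        Finset.sum_le_sum_of_subset_of_nonneg hsub fun _ _ _ => sq_nonneg _
    _ = ∑ c : Fin 4, ∑ d : Fin 4, ∑ x ∈ U.image (fun q => q.2.2), F c d x ^ 2 := by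
        simp only [Finset.sum_product]
    _ ≤ ∑ _c : Fin 4, ∑ _d : Fin 4, N := by
        refine Finset.sum_le_sum fun c _ => Finset.sum_le_sum fun d _ => hN c d _ fun x hx => ?_
        obtain ⟨q, hq, rfl⟩ := Finset.mem_image.mp hx
        exact hU q hq
    _ = 16 * N := by simp; ring

/-- If `F` has a definite mass on each of many disjoint small sets, then many of these sets do not
meet the places where `F` is large, and the small part of `F` has a definite norm on them. -/
theorem card_le_of_disjoint {ι : Type*} (I : Finset ι)
    (Z : ι → Finset (Fin 4 × Fin 4 × Vertex)) (hd : (I : Set ι).PairwiseDisjoint Z)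
    (F : Fin 4 → Fin 4 → Vertex → ℝ) (P : Vertex → Prop) (b κ n Nf Ns : ℝ) (hb : 0 < b)
    (hn : 0 ≤ n)
    (hP : ∀ i ∈ I, ∀ q ∈ Z i, P q.2.2)
    (hNf : ∀ c d (S : Finset Vertex), (∀ x ∈ S, P x) → ∑ x ∈ S, F c d x ^ 2 ≤ Nf)
    (hNs : ∀ c d (S : Finset Vertex), (∀ x ∈ S, P x) → ∑ x ∈ S, smallValue b (F c d x) ^ 2 ≤ Ns)
    (hcard : ∀ i ∈ I, ((Z i).card : ℝ) ≤ n)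
    (hmass : ∀ i ∈ I, 1 ≤ κ * ∑ q ∈ Z i, |F q.1 q.2.1 q.2.2|) :
    (I.card : ℝ) ≤ κ ^ 2 * n * (16 * Ns) + 16 * Nf / b ^ 2 := by
  classical
  have each : ∀ i ∈ I, 1 ≤ κ ^ 2 * n * ∑ q ∈ Z i, smallValue b (F q.1 q.2.1 q.2.2) ^ 2 +
      (∑ q ∈ Z i, F q.1 q.2.1 q.2.2 ^ 2) / b ^ 2 := by
    intro i hi
    -- A set where `|F|` reaches `b` makes the second term at least 1. On any other set `F` equals
    -- its small part, and Cauchy–Schwarz turns the mass into a first term of at least 1.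
    by_cases hlarge : ∃ q ∈ Z i, b ≤ |F q.1 q.2.1 q.2.2|
    · obtain ⟨q, hq, hbq⟩ := hlarge
      have h1 : 1 ≤ (∑ q ∈ Z i, F q.1 q.2.1 q.2.2 ^ 2) / b ^ 2 := by
        rw [le_div_iff₀ (by positivity), one_mul]
        calc b ^ 2 ≤ F q.1 q.2.1 q.2.2 ^ 2 := by
              rw [← sq_abs (F _ _ _)]; gcongr
          _ ≤ _ := Finset.single_le_sum (f := fun q : Fin 4 × Fin 4 × Vertex =>
              F q.1 q.2.1 q.2.2 ^ 2) (fun _ _ => sq_nonneg _) hq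
      have h2 : 0 ≤ κ ^ 2 * n * ∑ q ∈ Z i, smallValue b (F q.1 q.2.1 q.2.2) ^ 2 := by positivity
      linarith
    · push Not at hlarge
      have hs : ∑ q ∈ Z i, smallValue b (F q.1 q.2.1 q.2.2) ^ 2 =
          ∑ q ∈ Z i, |F q.1 q.2.1 q.2.2| ^ 2 :=
        Finset.sum_congr rfl fun q hq => by rw [smallValue, if_pos (hlarge q hq), sq_abs]
      have h1 : (∑ q ∈ Z i, |F q.1 q.2.1 q.2.2|) ^ 2 ≤
          (Z i).card * ∑ q ∈ Z i, |F q.1 q.2.1 q.2.2| ^ 2 := sq_sum_le_card_mul_sum_sq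
      have h2 : (1 : ℝ) ≤ (κ * ∑ q ∈ Z i, |F q.1 q.2.1 q.2.2|) ^ 2 := one_le_pow₀ (hmass i hi)
      have h3 : 0 ≤ (∑ q ∈ Z i, F q.1 q.2.1 q.2.2 ^ 2) / b ^ 2 := by positivity
      rw [hs]
      have h4 : (κ * ∑ q ∈ Z i, |F q.1 q.2.1 q.2.2|) ^ 2 ≤
          κ ^ 2 * n * ∑ q ∈ Z i, |F q.1 q.2.1 q.2.2| ^ 2 := by
        rw [mul_pow, mul_assoc]
        refine mul_le_mul_of_nonneg_left (h1.trans ?_) (sq_nonneg _)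
        exact mul_le_mul_of_nonneg_right (hcard i hi) (by positivity)
      linarith
  have hU : ∀ q ∈ I.biUnion Z, P q.2.2 := by
    intro q hq
    obtain ⟨i, hi, hq⟩ := Finset.mem_biUnion.mp hq
    exact hP i hi q hq
  calc (I.card : ℝ) = ∑ i ∈ I, (1 : ℝ) := by simp
    _ ≤ ∑ i ∈ I, (κ ^ 2 * n * ∑ q ∈ Z i, smallValue b (F q.1 q.2.1 q.2.2) ^ 2 +
      (∑ q ∈ Z i, F q.1 q.2.1 q.2.2 ^ 2) / b ^ 2) := Finset.sum_le_sum each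
    _ = κ ^ 2 * n * ∑ q ∈ I.biUnion Z, smallValue b (F q.1 q.2.1 q.2.2) ^ 2 +
      (∑ q ∈ I.biUnion Z, F q.1 q.2.1 q.2.2 ^ 2) / b ^ 2 := by
        rw [Finset.sum_biUnion hd, Finset.sum_biUnion hd, Finset.sum_add_distrib, Finset.mul_sum,
          Finset.sum_div]
    _ ≤ κ ^ 2 * n * (16 * Ns) + 16 * Nf / b ^ 2 := by
        gcongr
        · exact sum_index_sq_le (fun c d x => smallValue b (F c d x)) Ns P hNs _ hU
        · exact sum_index_sq_le F Nf P hNf _ hU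

/-! ### Sup-distances and cubes -/

/-- The sup-distance of `x` and `x₀`, measured in the coordinates in `E` only. -/
def supDist (E : Finset (Fin 4)) (x₀ x : Vertex) : ℕ := E.sup fun l => (x l - x₀ l).natAbs

theorem supDist_le_iff {E : Finset (Fin 4)} {x₀ x : Vertex} {r : ℕ} :
    supDist E x₀ x ≤ r ↔ ∀ l ∈ E, (x l - x₀ l).natAbs ≤ r := by
  simp [supDist, Finset.sup_le_iff]

theorem natAbs_le_supDist {E : Finset (Fin 4)} (x₀ x : Vertex) {l : Fin 4} (hl : l ∈ E) :
    (x l - x₀ l).natAbs ≤ supDist E x₀ x :=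
  supDist_le_iff.mp le_rfl l hl

theorem supDist_add_unitVec_le (E : Finset (Fin 4)) (x₀ x : Vertex) (c : Fin 4) :
    supDist E x₀ (x + unitVec c) ≤ supDist E x₀ x + 1 := by
  refine supDist_le_iff.mpr fun l hl => ?_
  have := natAbs_le_supDist x₀ x hl
  simp only [Pi.add_apply, unitVec_apply]
  split_ifs <;> omega

theorem supDist_sub_unitVec_le (E : Finset (Fin 4)) (x₀ x : Vertex) (c : Fin 4) :
    supDist E x₀ (x - unitVec c) ≤ supDist E x₀ x + 1 := by
  refine supDist_le_iff.mpr fun l hl => ?_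
  have := natAbs_le_supDist x₀ x hl
  simp only [Pi.sub_apply, unitVec_apply]
  split_ifs <;> omega

theorem supDist_le_add_unitVec (E : Finset (Fin 4)) (x₀ x : Vertex) (c : Fin 4) :
    supDist E x₀ x ≤ supDist E x₀ (x + unitVec c) + 1 := by
  simpa using supDist_sub_unitVec_le E x₀ (x + unitVec c) c

theorem supDist_le_sub_unitVec (E : Finset (Fin 4)) (x₀ x : Vertex) (c : Fin 4) :
    supDist E x₀ x ≤ supDist E x₀ (x - unitVec c) + 1 := by
  simpa using supDist_add_unitVec_le E x₀ (x - unitVec c) c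

/-- The points of the cube of radius `r` around `y`. -/
noncomputable def cube (y : Vertex) (r : ℕ) : Finset Vertex :=
  Finset.Icc (fun l => y l - r) (fun l => y l + r)

theorem mem_cube {y x : Vertex} {r : ℕ} : x ∈ cube y r ↔ ∀ l, |x l - y l| ≤ r := by
  simp only [cube, Finset.mem_Icc, Pi.le_def, abs_le, ← forall_and]
  exact forall_congr' fun l => by constructor <;> rintro ⟨h1, h2⟩ <;> constructor <;> linarith

theorem card_cube (y : Vertex) (r : ℕ) : (cube y r).card = (2 * r + 1) ^ 4 := by
  rw [cube, Pi.card_Icc]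
  have : ∀ l, (Finset.Icc (y l - r) (y l + r)).card = 2 * r + 1 := fun l => by
    rw [Int.card_Icc]; omega
  simp [this]

theorem mem_cube_of_supDist_univ {x₀ x : Vertex} {r : ℕ}
    (h : supDist Finset.univ x₀ x ≤ r) : x ∈ cube x₀ r := by
  rw [mem_cube]
  intro l
  have := supDist_le_iff.mp h l (Finset.mem_univ l)
  rw [abs_le]
  omega

theorem corner_add_mem_vertices (R : Rectangle) {s t : ℕ} (hs : s ≤ R.length)
    (ht : t ≤ R.height) : R.corner + s • unitVec R.dirL + t • unitVec R.dirH ∈ R.vertices :=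
  ⟨s, t, hs, ht, rfl⟩

theorem curl_single_of_ne {a b : Fin 4} (hab : a ≠ b) (h : Vertex → ℝ) (x : Vertex) :
    curl (Pi.single b h) a b x = h (x + unitVec a) - h x := by
  simp [curl, Pi.single_eq_of_ne hab]

/-! ### Shells around the edges of a long side -/

/-- Away from the ends of a side, a unit of flux leaves each edge of the side through each of the
concentric shells around it. -/
theorem height_mul_le {R : Rectangle} {M : ℕ} {b : ℝ} {Θ : Fin 4 → Vertex → ℝ} {σ Nf Ns : ℝ}
    (hF : IsLocalProjection R M b Θ σ Nf Ns) (hb : 0 < b) (n : ℕ) (hL : 2 * n ≤ R.length)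
    (hM : 2 * n ≤ M) :
    (R.height * n : ℝ) ≤ 1 ^ 2 * (16 * (4 * n + 1 : ℝ) ^ 4) * (16 * Ns) + 16 * Nf / b ^ 2 := by
  classical
  set E : Finset (Fin 4) := {R.dirH}ᶜ with hE
  have hmemE : ∀ l, l ∈ E ↔ l ≠ R.dirH := by simp [hE]
  set ρ : Vertex → ℕ := supDist E R.corner with hρ
  set y : ℕ → Vertex := fun t => R.corner + t • unitVec R.dirH with hy
  have hyv : ∀ t ≤ R.height, y t ∈ R.vertices := fun t ht => by
    simpa [hy] using corner_add_mem_vertices R (Nat.zero_le _) ht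
  -- Shell `i` in the hyperplane at height `t` consists of the distances `2 * i` and `2 * i + 1`.
  -- This thickness contains every `x` at which some unit step crosses the sphere of radius `2 * i`,
  -- and keeps the shells disjoint.
  set X : ℕ × ℕ → Finset Vertex := fun p => (cube (y p.1) (2 * n)).filter
    fun x => x R.dirH = R.corner R.dirH + p.1 ∧ ρ x / 2 = p.2 with hX
  have hcube : ∀ (t r : ℕ) (x : Vertex), x R.dirH = R.corner R.dirH + t → ρ x ≤ r →
      ∀ l, |x l - y t l| ≤ r := by
    intro t r x hxt hxr l
    simp only [hy, Pi.add_apply, nsmul_unitVec_apply]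
    by_cases hl : l = R.dirH
    · subst hl; rw [if_pos rfl, hxt]; simp
    · rw [if_neg hl]
      have := supDist_le_iff.mp hxr l ((hmemE l).mpr hl)
      rw [abs_le]; omega
  have key := card_le_of_disjoint (Finset.range R.height ×ˢ Finset.range n)
    (fun p => Finset.univ ×ˢ Finset.univ ×ˢ X p) ?_ (curl Θ) (R.Near (M + 1)) b 1
    (16 * (4 * n + 1 : ℝ) ^ 4) Nf Ns hb (by positivity) ?_ hF.sum_sq_le hF.sum_small_sq_le ?_ ?_
  · simpa using key
  · intro p _ p' _ hpp'
    rw [Function.onFun, Finset.disjoint_left]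
    rintro ⟨c, d, x⟩ h h'
    simp only [hX, Finset.mem_product, Finset.mem_filter] at h h'
    apply hpp'
    ext
    · have := h.2.2.2.1.symm.trans h'.2.2.2.1
      omega
    · exact h.2.2.2.2.symm.trans h'.2.2.2.2
  · rintro ⟨t, i⟩ hti ⟨c, d, x⟩ hq
    simp only [hX, Finset.mem_product, Finset.mem_filter, Finset.mem_range] at hti hq
    refine Rectangle.Near.mono (hM.trans M.le_succ) ⟨y t, hyv t hti.1.le, mem_cube.mp hq.2.2.1⟩
  · rintro ⟨t, i⟩ -
    have h1 : (X (t, i)).card ≤ (2 * (2 * n) + 1) ^ 4 := by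
      rw [← card_cube (y t)]; exact Finset.card_filter_le _ _
    have h2 : ((X (t, i)).card : ℝ) ≤ (4 * n + 1 : ℝ) ^ 4 := by
      calc ((X (t, i)).card : ℝ) ≤ (((2 * (2 * n) + 1) ^ 4 : ℕ) : ℝ) := by exact_mod_cast h1
        _ = _ := by push_cast; ring
    simp only [Finset.card_product, Finset.card_univ, Fintype.card_fin]
    push_cast
    linarith
  · rintro ⟨t, i⟩ hti
    simp only [Finset.mem_product, Finset.mem_range] at hti
    obtain ⟨ht, hi⟩ := hti
    -- The test form is the indicator of the edges in direction `dirH` based in a three-dimensional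
    -- ball around one edge of the side.
    set h : Vertex → ℝ := fun x =>
      if x R.dirH = R.corner R.dirH + t ∧ ρ x ≤ 2 * i then 1 else 0 with hh
    have hweak := hF.weak R.dirH h fun x hx => by
      have hx' : x R.dirH = R.corner R.dirH + t ∧ ρ x ≤ 2 * i := by
        by_contra hne; exact hx (if_neg hne)
      exact Rectangle.Near.mono (by omega : 2 * i ≤ M)
        ⟨y t, hyv t ht.le, hcube t _ x hx'.1 hx'.2⟩
    have hrhs : rectSum (curl (Pi.single R.dirH h)) R.dirL R.dirH R.length R.height R.corner
        = -1 := by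
      unfold rectSum
      simp only [curl_single_of_ne R.dir_ne]
      rw [Finset.sum_comm]
      have h1 : ∀ t' ∈ Finset.range R.height, ∑ s ∈ Finset.range R.length,
          (h (R.corner + s • unitVec R.dirL + t' • unitVec R.dirH + unitVec R.dirL) -
            h (R.corner + s • unitVec R.dirL + t' • unitVec R.dirH)) =
          if t' = t then -1 else 0 := by
        intro t' _
        have := Finset.sum_range_sub
          (fun s : ℕ => h (R.corner + s • unitVec R.dirL + t' • unitVec R.dirH)) R.length
        simp only [add_smul, one_smul] at this
        rw [Finset.sum_congr rfl fun s _ => by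
          rw [add_right_comm _ _ (unitVec R.dirL), add_assoc R.corner], this]
        -- The opposite side is outside the ball, because `2 * i < 2 * n ≤ R.length`. Thus the
        -- telescoped sum keeps only the near end.
        have e1 : h (R.corner + R.length • unitVec R.dirL + t' • unitVec R.dirH) = 0 := by
          refine if_neg fun hc => ?_
          have := supDist_le_iff.mp hc.2 R.dirL ((hmemE _).mpr R.dir_ne)
          simp only [Pi.add_apply, nsmul_unitVec_apply, if_neg R.dir_ne, if_true] at this
          omega
        have e2 : h (R.corner + 0 • unitVec R.dirL + t' • unitVec R.dirH) =
            if t' = t then 1 else 0 := by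
          have hr : ρ (R.corner + 0 • unitVec R.dirL + t' • unitVec R.dirH) ≤ 2 * i := by
            refine supDist_le_iff.mpr fun l hl => ?_
            simp [unitVec_apply, (hmemE l).mp hl]
          simp only [hh, hr, and_true]
          simp [unitVec_apply]
        rw [e1, e2]
        split_ifs <;> simp
      rw [Finset.sum_congr rfl h1]
      simp [ht]
    rw [hrhs] at hweak
    have hzero : ∀ x, x ∉ X (t, i) →
        ∑ c, curl Θ c R.dirH x * (h (x + unitVec c) - h x) = 0 := by
      intro x hx
      refine Finset.sum_eq_zero fun c _ => ?_
      by_cases hc : c = R.dirH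
      · subst hc; rw [curl_self, zero_mul]
      have hxb : (x + unitVec c) R.dirH = x R.dirH := by
        simp [unitVec_apply, Ne.symm hc]
      have hne : h (x + unitVec c) = h x := by
        by_cases hxt : x R.dirH = R.corner R.dirH + t
        · have h1 : ρ (x + unitVec c) ≤ ρ x + 1 := supDist_add_unitVec_le E R.corner x c
          have h2 : ρ x ≤ ρ (x + unitVec c) + 1 := supDist_le_add_unitVec E R.corner x c
          have h3 : ρ x / 2 ≠ i := by
            intro h3
            refine hx (Finset.mem_filter.mpr ⟨mem_cube.mpr ?_, hxt, h3⟩)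
            exact hcube t _ x hxt (by omega)
          have h4 : ρ (x + unitVec c) ≤ 2 * i ↔ ρ x ≤ 2 * i := by omega
          simp only [hh, hxb, hxt, h4]
        · simp only [hh, hxb, hxt, false_and]
      rw [hne, sub_self, mul_zero]
    rw [tsum_eq_sum fun x hx => hzero x hx] at hweak
    have habs : (1 : ℝ) = |∑ x ∈ X (t, i), ∑ c, curl Θ c R.dirH x * (h (x + unitVec c) - h x)| := by
      rw [hweak, abs_mul, hF.abs_sign]; simp
    have hcoef : ∀ x c, |h (x + unitVec c) - h x| ≤ 1 := by
      intro x c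
      simp only [hh]
      split_ifs <;> simp
    rw [one_mul, Finset.sum_product]
    simp only [Finset.sum_product]
    calc (1 : ℝ) ≤ ∑ x ∈ X (t, i), ∑ c, |curl Θ c R.dirH x * (h (x + unitVec c) - h x)| := by
          rw [habs]
          exact (Finset.abs_sum_le_sum_abs _ _).trans
            (Finset.sum_le_sum fun x _ => Finset.abs_sum_le_sum_abs _ _)
      _ ≤ ∑ x ∈ X (t, i), ∑ c, |curl Θ c R.dirH x| := by
          refine Finset.sum_le_sum fun x _ => Finset.sum_le_sum fun c _ => ?_
          rw [abs_mul]
          exact mul_le_of_le_one_right (abs_nonneg _) (hcoef x c)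
      _ = ∑ c, ∑ x ∈ X (t, i), |curl Θ c R.dirH x| := Finset.sum_comm
      _ ≤ _ := by
          refine Finset.sum_le_sum fun c _ => ?_
          exact Finset.single_le_sum (f := fun d => ∑ x ∈ X (t, i), |curl Θ c d x|)
            (fun _ _ => Finset.sum_nonneg fun _ _ => abs_nonneg _) (Finset.mem_univ R.dirH)

/-- Summation by parts: `B` contains the supports of `ω` and of its shift, so no boundary terms
arise. -/
theorem sum_mul_shift_sub (B : Finset Vertex) (ω G : Vertex → ℝ) (e : Vertex)
    (h₁ : ∀ x, x ∉ B → ω x = 0) (h₂ : ∀ x, x ∉ B → ω (x - e) = 0) :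
    ∑ x ∈ B, ω x * (G (x + e) - G x) = ∑ x ∈ B, (ω (x - e) - ω x) * G x := by
  have h : ∑ x ∈ B, ω x * G (x + e) = ∑ x ∈ B, ω (x - e) * G x := by
    rw [← tsum_eq_sum (f := fun x => ω x * G (x + e)) (L := .unconditional _)
        (fun x hx => by rw [h₁ x hx, zero_mul]),
      ← tsum_eq_sum (f := fun x => ω (x - e) * G x) (L := .unconditional _)
        (fun x hx => by rw [h₂ x hx, zero_mul]),
      ← (Equiv.addRight e).tsum_eq (fun x => ω (x - e) * G x)]
    simp
  simp only [mul_sub, sub_mul, Finset.sum_sub_distrib, h]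

/-! ### Shells around a small rectangle -/

/-- The magnetic moment of the rectangle passes through each of the concentric shells around it. -/
theorem count_le_of_small {R : Rectangle} {M : ℕ} {b : ℝ} {Θ : Fin 4 → Vertex → ℝ} {σ Nf Ns : ℝ}
    (hF : IsLocalProjection R M b Θ σ Nf Ns) (hb : 0 < b) (q n : ℕ) (hL : R.length ≤ q)
    (hH : R.height ≤ q) (hL0 : 0 < R.length) (hH0 : 0 < R.height) (hM : 2 * (q + n) ≤ M) :
    (n : ℝ) ≤ (16 * (q + n)) ^ 2 * (16 * (4 * (q + n) + 1 : ℝ) ^ 4) * (16 * Ns) +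
      16 * Nf / b ^ 2 := by
  classical
  set ρ : Vertex → ℕ := supDist Finset.univ R.corner with hρ
  set B := cube R.corner (2 * (q + n)) with hB
  set X : ℕ → Finset Vertex := fun i => B.filter fun x => ρ x / 2 = i with hX
  have hcorner : R.corner ∈ R.vertices := by
    simpa using corner_add_mem_vertices R (Nat.zero_le _) (Nat.zero_le _)
  -- Starting at `i = q` puts the base points of the cells of the rectangle strictly inside the ball
  -- of radius `2 * i`.
  have key := card_le_of_disjoint (Finset.Ico q (q + n))
    (fun i => Finset.univ ×ˢ Finset.univ ×ˢ X i) ?_ (curl Θ) (R.Near (M + 1)) b (16 * (q + n))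
    (16 * (4 * (q + n) + 1 : ℝ) ^ 4) Nf Ns hb (by positivity) ?_ hF.sum_sq_le hF.sum_small_sq_le
    ?_ ?_
  · simpa using key
  · intro i _ i' _ hii'
    rw [Function.onFun, Finset.disjoint_left]
    rintro ⟨c, d, x⟩ h h'
    simp only [hX, Finset.mem_product, Finset.mem_filter] at h h'
    exact hii' (h.2.2.2.symm.trans h'.2.2.2)
  · rintro i - ⟨c, d, x⟩ hq
    simp only [hX, Finset.mem_product, Finset.mem_filter] at hq
    exact Rectangle.Near.mono (hM.trans M.le_succ) ⟨_, hcorner, mem_cube.mp hq.2.2.1⟩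
  · rintro i -
    have h1 : (X i).card ≤ (2 * (2 * (q + n)) + 1) ^ 4 := by
      rw [← card_cube R.corner]; exact Finset.card_filter_le _ _
    have h2 : ((X i).card : ℝ) ≤ (4 * (q + n) + 1 : ℝ) ^ 4 := by
      calc ((X i).card : ℝ) ≤ (((2 * (2 * (q + n)) + 1) ^ 4 : ℕ) : ℝ) := by exact_mod_cast h1
        _ = _ := by push_cast; ring
    simp only [Finset.card_product, Finset.card_univ, Fintype.card_fin]
    push_cast
    linarith
  · intro i hi
    obtain ⟨hqi, hin⟩ := Finset.mem_Ico.mp hi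
    -- A direction normal to the rectangle, along which closedness will be tested.
    obtain ⟨c₀, hca, hcb⟩ : ∃ c, c ≠ R.dirL ∧ c ≠ R.dirH := by
      generalize R.dirL = a
      generalize R.dirH = b
      revert a b
      decide
    have hab := R.dir_ne
    -- Coordinate functions cut off at radius `2 * i`: their differences are constant inside the
    -- shell and zero outside it.
    set g : Fin 4 → Vertex → ℝ := fun l x =>
      if ρ x ≤ 2 * i then ((x l - R.corner l : ℤ) : ℝ) else 0 with hg
    have hgB : ∀ l x, x ∉ B → g l x = 0 := fun l x hx => if_neg fun h =>
      hx (mem_cube_of_supDist_univ (le_trans h (by omega)))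
    have hgB' : ∀ l c x, x ∉ B → g l (x - unitVec c) = 0 := fun l c x hx => if_neg fun h => by
      have : ρ x ≤ ρ (x - unitVec c) + 1 := supDist_le_sub_unitVec Finset.univ R.corner x c
      exact hx (mem_cube_of_supDist_univ (le_trans this (by omega)))
    have hgB'' : ∀ l c x, x ∉ B → g l (x + unitVec c) = 0 := fun l c x hx => if_neg fun h => by
      have : ρ x ≤ ρ (x + unitVec c) + 1 := supDist_le_add_unitVec Finset.univ R.corner x c
      exact hx (mem_cube_of_supDist_univ (le_trans this (by omega)))
    have hbound : ∀ l x, |g l x| ≤ 2 * i := by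
      intro l x
      simp only [hg]
      split_ifs with h
      · have h1 : _ ≤ ρ x := natAbs_le_supDist R.corner x (Finset.mem_univ l)
        have h2 : |x l - R.corner l| ≤ 2 * i := by
          rw [abs_le]; omega
        exact_mod_cast h2
      · simp
    have hbound2 : ∀ l x x', |g l x - g l x'| ≤ 4 * i := by
      intro l x x'
      calc |g l x - g l x'| ≤ |g l x| + |g l x'| := abs_sub _ _
        _ ≤ 4 * i := by linarith [hbound l x, hbound l x']
    have hinner : ∀ l c x, ρ x < 2 * i →
        g l (x + unitVec c) - g l x = (if l = c then 1 else 0) ∧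
        g l (x - unitVec c) - g l x = -(if l = c then 1 else 0) := by
      intro l c x hx
      have h1 : ρ (x + unitVec c) ≤ 2 * i :=
        (supDist_add_unitVec_le Finset.univ R.corner x c).trans hx
      have h2 : ρ (x - unitVec c) ≤ 2 * i :=
        (supDist_sub_unitVec_le Finset.univ R.corner x c).trans hx
      simp only [hg, if_pos h1, if_pos h2, if_pos hx.le, Pi.add_apply, Pi.sub_apply, unitVec_apply]
      constructor <;> split_ifs <;> push_cast <;> ring
    have houter : ∀ l c x, 2 * i + 1 < ρ x →
        g l (x + unitVec c) - g l x = 0 ∧ g l (x - unitVec c) - g l x = 0 := by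
      intro l c x hx
      have h1 : ¬ ρ (x + unitVec c) ≤ 2 * i := by
        have : ρ x ≤ ρ (x + unitVec c) + 1 := supDist_le_add_unitVec Finset.univ R.corner x c
        omega
      have h2 : ¬ ρ (x - unitVec c) ≤ 2 * i := by
        have : ρ x ≤ ρ (x - unitVec c) + 1 := supDist_le_sub_unitVec Finset.univ R.corner x c
        omega
      have h3 : ¬ ρ x ≤ 2 * i := by omega
      simp only [hg, if_neg h1, if_neg h2, if_neg h3, sub_self, and_self]
    have hweak := hF.weak R.dirH (g R.dirL) fun x hx => by
      have hx' : ρ x ≤ 2 * i := by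
        by_contra hne; exact hx (if_neg hne)
      exact Rectangle.Near.mono (by omega : 2 * i ≤ M)
        ⟨_, hcorner, mem_cube.mp (mem_cube_of_supDist_univ hx')⟩
    have hrhs : rectSum (curl (Pi.single R.dirH (g R.dirL))) R.dirL R.dirH R.length R.height
        R.corner = R.length * R.height := by
      unfold rectSum
      simp only [curl_single_of_ne hab]
      have h1 : ∀ s ∈ Finset.range R.length, ∀ t ∈ Finset.range R.height,
          g R.dirL (R.corner + s • unitVec R.dirL + t • unitVec R.dirH + unitVec R.dirL) -
            g R.dirL (R.corner + s • unitVec R.dirL + t • unitVec R.dirH) = 1 := by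
        intro s hs t ht
        rw [Finset.mem_range] at hs ht
        refine ((hinner R.dirL R.dirL _ ?_).1).trans (if_pos rfl)
        suffices h : ρ (R.corner + s • unitVec R.dirL + t • unitVec R.dirH) ≤ 2 * i - 1 by omega
        refine supDist_le_iff.mpr fun l _ => ?_
        simp only [Pi.add_apply, nsmul_unitVec_apply]
        by_cases h : l = R.dirL
        · have h' : l ≠ R.dirH := fun h' => hab (h.symm.trans h')
          simp only [if_pos h, if_neg h']; omega
        · simp only [if_neg h]
          split_ifs <;> omega
      rw [Finset.sum_congr rfl fun s hs => Finset.sum_congr rfl (h1 s hs)]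
      simp
    rw [hrhs, tsum_eq_sum (s := B) (fun x hx => Finset.sum_eq_zero fun c _ => by
      rw [hgB _ x hx, hgB'' _ c x hx, sub_self, mul_zero])] at hweak
    -- Closedness in the directions `dirL`, `dirH`, `c₀`, tested against the cut-off coordinate `g
    -- c₀` and summed by parts.
    have hclosed : ∑ x ∈ B, (g c₀ (x - unitVec c₀) - g c₀ x) * curl Θ R.dirL R.dirH x =
        ∑ x ∈ B, (g c₀ (x - unitVec R.dirL) - g c₀ x) * curl Θ c₀ R.dirH x +
        ∑ x ∈ B, (g c₀ (x - unitVec R.dirH) - g c₀ x) * curl Θ R.dirL c₀ x := by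
      rw [← sum_mul_shift_sub B (g c₀) (curl Θ R.dirL R.dirH) _ (hgB c₀) (hgB' c₀ _),
        ← sum_mul_shift_sub B (g c₀) (curl Θ c₀ R.dirH) _ (hgB c₀) (hgB' c₀ _),
        ← sum_mul_shift_sub B (g c₀) (curl Θ R.dirL c₀) _ (hgB c₀) (hgB' c₀ _),
        ← Finset.sum_add_distrib]
      refine Finset.sum_congr rfl fun x _ => ?_
      rw [curl_closed Θ R.dirL R.dirH c₀ x, mul_add]
    -- Inside the shell the coclosed identity contributes `curl Θ R.dirL R.dirH x`, and the closed
    -- one contributes its negative. So `D` lives on the shell, although its sum is the full moment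
    -- `σ * (L * H)`.
    set D : Vertex → ℝ := fun x =>
      ∑ c, curl Θ c R.dirH x * (g R.dirL (x + unitVec c) - g R.dirL x) +
      (g c₀ (x - unitVec c₀) - g c₀ x) * curl Θ R.dirL R.dirH x -
      ((g c₀ (x - unitVec R.dirL) - g c₀ x) * curl Θ c₀ R.dirH x +
        (g c₀ (x - unitVec R.dirH) - g c₀ x) * curl Θ R.dirL c₀ x) with hD
    have hDsum : ∑ x ∈ B, D x = σ * (R.length * R.height) := by
      simp only [hD, Finset.sum_sub_distrib, Finset.sum_add_distrib]
      rw [hweak, hclosed]; ring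
    have hDzero : ∀ x, ρ x / 2 ≠ i → D x = 0 := by
      intro x hx
      rcases lt_or_ge (ρ x) (2 * i) with h | h
      · simp only [hD, (hinner _ _ x h).1, (hinner _ _ x h).2, if_neg hca, if_neg hcb, if_true]
        simp
      · have h' : 2 * i + 1 < ρ x := by omega
        simp only [hD, (houter _ _ x h').1, (houter _ _ x h').2]
        simp
    have hDbound : ∀ x, |D x| ≤ 16 * i * ∑ c, ∑ d, |curl Θ c d x| := by
      intro x
      have hcd : ∀ c d, |curl Θ c d x| ≤ ∑ c, ∑ d, |curl Θ c d x| := fun c d =>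
        (Finset.single_le_sum (f := fun d => |curl Θ c d x|) (fun _ _ => abs_nonneg _)
          (Finset.mem_univ d)).trans
        (Finset.single_le_sum (f := fun c => ∑ d, |curl Θ c d x|)
          (fun _ _ => Finset.sum_nonneg fun _ _ => abs_nonneg _) (Finset.mem_univ c))
      have h1 : |∑ c, curl Θ c R.dirH x * (g R.dirL (x + unitVec c) - g R.dirL x)| ≤
          4 * i * ∑ c, ∑ d, |curl Θ c d x| := by
        rw [Finset.mul_sum]
        refine (Finset.abs_sum_le_sum_abs _ _).trans (Finset.sum_le_sum fun c _ => ?_)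
        rw [abs_mul, mul_comm]
        exact mul_le_mul (hbound2 _ _ _) (Finset.single_le_sum (f := fun d => |curl Θ c d x|)
          (fun _ _ => abs_nonneg _) (Finset.mem_univ _)) (abs_nonneg _) (by positivity)
      have h2 : ∀ x' c d, |(g c₀ x' - g c₀ x) * curl Θ c d x| ≤
          4 * i * ∑ c, ∑ d, |curl Θ c d x| := by
        intro x' c d
        rw [abs_mul]
        exact mul_le_mul (hbound2 _ _ _) (hcd c d) (abs_nonneg _) (by positivity)
      have h3 := h2 (x - unitVec c₀) R.dirL R.dirH
      have h4 := h2 (x - unitVec R.dirL) c₀ R.dirH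
      have h5 := h2 (x - unitVec R.dirH) R.dirL c₀
      simp only [hD]
      rw [abs_le] at h1 h3 h4 h5 ⊢
      constructor <;> linarith [h1.1, h1.2, h3.1, h3.2, h4.1, h4.2, h5.1, h5.2]
    have hLH : (1 : ℝ) ≤ |∑ x ∈ B, D x| := by
      rw [hDsum, abs_mul, hF.abs_sign, one_mul, abs_of_nonneg (by positivity)]
      have : 1 ≤ R.length * R.height := Nat.mul_pos hL0 hH0
      exact_mod_cast this
    have hfilter : ∑ x ∈ B, D x = ∑ x ∈ X i, D x := by
      rw [hX, Finset.sum_filter]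
      refine Finset.sum_congr rfl fun x _ => ?_
      split_ifs with h
      · rfl
      · exact hDzero x h
    have hi' : (i : ℝ) ≤ q + n := by
      have : i ≤ q + n := hin.le
      exact_mod_cast this
    calc (1 : ℝ) ≤ ∑ x ∈ X i, |D x| := by
          rw [hfilter] at hLH
          exact hLH.trans (Finset.abs_sum_le_sum_abs _ _)
      _ ≤ ∑ x ∈ X i, 16 * (q + n) * ∑ c, ∑ d, |curl Θ c d x| := by
          refine Finset.sum_le_sum fun x _ => (hDbound x).trans ?_
          gcongr
      _ = 16 * (q + n) * ∑ q ∈ Finset.univ ×ˢ Finset.univ ×ˢ X i, |curl Θ q.1 q.2.1 q.2.2| := by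
          rw [← Finset.mul_sum, Finset.sum_comm, Finset.sum_product]
          simp only [Finset.sum_product]
          congr 1
          exact Finset.sum_congr rfl fun c _ => Finset.sum_comm

/-! ### From `2`-forms on the cube to functions on the lattice -/

theorem mem_vertices_iff (R : Rectangle) (x : Vertex) :
    x ∈ R.vertices ↔ ∀ l, R.corner l ≤ x l ∧ x l ≤ R.corner l +
      (if l = R.dirL then (R.length : ℤ) else 0) + (if l = R.dirH then (R.height : ℤ) else 0) := by
  have hab := R.dir_ne
  constructor
  · rintro ⟨s, t, hs, ht, rfl⟩ l
    simp only [Pi.add_apply, nsmul_unitVec_apply]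
    split_ifs <;> omega
  · intro h
    have ha := h R.dirL
    have hb := h R.dirH
    simp only [if_true, if_neg hab, if_neg hab.symm] at ha hb
    refine ⟨(x R.dirL - R.corner R.dirL).toNat, (x R.dirH - R.corner R.dirH).toNat, by omega,
      by omega, ?_⟩
    funext l
    have hl := h l
    simp only [Pi.add_apply, nsmul_unitVec_apply]
    by_cases h1 : l = R.dirL
    · subst h1
      simp only [if_true, if_neg hab]
      omega
    · by_cases h2 : l = R.dirH
      · subst h2
        simp only [if_true, if_neg hab.symm]
        omega
      · simp only [if_neg h1, if_neg h2] at hl ⊢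
        omega

theorem mem_cells_iff (R : Rectangle) {j : ℕ∞} (p : Plaquette j) :
    p ∈ R.cells j ↔ ∃ s < R.length, ∃ t < R.height,
      p.base = R.corner + s • unitVec R.dirL + t • unitVec R.dirH ∧
      ((p.dir₁ = R.dirL ∧ p.dir₂ = R.dirH) ∨ (p.dir₁ = R.dirH ∧ p.dir₂ = R.dirL)) := by
  have hab := R.dir_ne
  have hlt := p.dir_lt.ne
  constructor
  · intro hp
    have hp : p.corners ⊆ R.vertices := hp
    have h0 : p.base ∈ R.vertices := hp (by simp [Plaquette.corners])
    have h12 : p.base + unitVec p.dir₁ + unitVec p.dir₂ ∈ R.vertices :=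
      hp (by simp [Plaquette.corners])
    obtain ⟨s, t, hs, ht, hst⟩ := id h0
    rw [mem_vertices_iff] at h0 h12
    simp only [Pi.add_apply, unitVec_apply] at h12
    have key : ∀ l, l = p.dir₁ ∨ l = p.dir₂ → l = R.dirL ∨ l = R.dirH := by
      intro l hl
      by_contra! hne
      have h1 := h0 l
      have h2 := h12 l
      rw [if_neg hne.1, if_neg hne.2] at h2
      rcases hl with rfl | rfl
      · rw [if_pos rfl, if_neg hlt] at h2; omega
      · rw [if_pos rfl, if_neg hlt.symm] at h2; omega
    have hdirs : (p.dir₁ = R.dirL ∧ p.dir₂ = R.dirH) ∨ (p.dir₁ = R.dirH ∧ p.dir₂ = R.dirL) := by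
      rcases key p.dir₁ (.inl rfl) with h1 | h1 <;> rcases key p.dir₂ (.inr rfl) with h2 | h2
      · exact absurd (h1.trans h2.symm) hlt
      · exact .inl ⟨h1, h2⟩
      · exact .inr ⟨h1, h2⟩
      · exact absurd (h1.trans h2.symm) hlt
    have ha := h12 R.dirL
    have hb := h12 R.dirH
    simp only [hst, Pi.add_apply, nsmul_unitVec_apply] at ha hb
    refine ⟨s, ?_, t, ?_, hst, hdirs⟩
    · rcases hdirs with ⟨h1, h2⟩ | ⟨h1, h2⟩ <;>
        simp only [h1, h2, if_true, if_neg hab] at ha <;> omega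
    · rcases hdirs with ⟨h1, h2⟩ | ⟨h1, h2⟩ <;>
        simp only [h1, h2, if_true, if_neg hab.symm] at hb <;> omega
  · rintro ⟨s, hs, t, ht, hbase, hdirs⟩
    change p.corners ⊆ R.vertices
    intro x hx
    rw [mem_vertices_iff]
    intro l
    simp only [Plaquette.corners, Set.mem_insert_iff, Set.mem_singleton_iff, hbase] at hx
    rcases hdirs with ⟨h1, h2⟩ | ⟨h1, h2⟩ <;> rw [h1, h2] at hx <;>
      rcases hx with rfl | rfl | rfl | rfl <;>
      simp only [Pi.add_apply, nsmul_unitVec_apply, unitVec_apply] <;> split_ifs <;> omega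

/-- A point near the rectangle is in the interior of the box. -/
theorem Rectangle.Near.natAbs_lt {R : Rectangle} {j : ℕ∞} (hR : ∀ x ∈ R.vertices, InBox j x)
    {m : ℕ} (hfar : R.FarFromBoundary j m) {x : Vertex} (hx : R.Near m x) (l : Fin 4) :
    ((x l).natAbs : ℕ∞) < j := by
  obtain ⟨y, hy, hxy⟩ := hx
  by_contra! hj
  obtain ⟨J, rfl⟩ : ∃ J : ℕ, j = J := ⟨j.toNat, (ENat.natCast_toNat (ne_top_of_le_ne_top
    (ENat.natCast_ne_top _) hj)).symm⟩
  have hJ : J ≤ (x l).natAbs := by exact_mod_cast hj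
  have hyJ : ∀ i, (y i).natAbs ≤ J := fun i => by exact_mod_cast hR y hy i
  -- If `x` were not interior, changing the coordinate `l` of the nearby rectangle point `y` to `±
  -- J` would give a boundary point too close to `y`.
  obtain ⟨u, hu, hyu⟩ : ∃ u : ℤ, u.natAbs = J ∧ |y l - u| ≤ m := by
    have h1 := abs_le.mp (hxy l)
    have h2 := hyJ l
    rcases le_or_gt 0 (x l) with h | h
    · exact ⟨J, by omega, by rw [abs_le]; omega⟩
    · exact ⟨-J, by omega, by rw [abs_le]; omega⟩
  have hz : Function.update y l u ∈ boundaryVertices (J : ℕ∞) := by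
    refine ⟨fun i => ?_, l, by rw [Function.update_self, hu]⟩
    by_cases h : i = l
    · subst h; rw [Function.update_self, hu]
    · rw [Function.update_of_ne h]; exact hR y hy i
  have hlt := hfar y hy _ hz
  refine absurd hlt (not_lt.mpr ?_)
  rw [dist_pi_le_iff (by positivity)]
  intro i
  by_cases h : i = l
  · subst h
    rw [Function.update_self, Int.dist_eq]
    exact_mod_cast hyu
  · rw [Function.update_of_ne h, dist_self]; positivity

theorem Rectangle.finite_near (R : Rectangle) (M : ℕ) : {x | R.Near M x}.Finite := by
  refine (R.vertices_finite.biUnion fun y _ => (cube y M).finite_toSet).subset ?_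
  rintro x ⟨y, hy, h⟩
  exact Set.mem_biUnion hy (mem_cube.mpr h)

theorem exists_plaquette {R : Rectangle} {j : ℕ∞} {m : ℕ}
    (hbox : ∀ x, R.Near (m + 1) x → InBox j x) {x : Vertex} (hx : R.Near m x) {c d : Fin 4}
    (hcd : c < d) : ∃ p : Plaquette j, p.base = x ∧ p.dir₁ = c ∧ p.dir₂ = d := by
  refine ⟨⟨x, c, d, hcd, hbox _ (hx.mono m.le_succ), hbox _ (hx.add_unitVec c),
    hbox _ (hx.add_unitVec d), hbox _ ?_⟩, rfl, rfl, rfl⟩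
  obtain ⟨y, hy, h⟩ := hx
  refine ⟨y, hy, fun l => ?_⟩
  have := abs_le.mp (h l)
  simp only [Pi.add_apply, unitVec_apply, abs_le]
  push_cast
  split_ifs with h1 h2
  · exact absurd (h1.symm.trans h2) hcd.ne
  all_goals constructor <;> linarith [this.1, this.2]

/-- A finite part of the squared norm of a `2`-form. -/
theorem sum_sq_le_norm_sq {j : ℕ∞} (g : TwoForm j) (G : Vertex → ℝ) (c d : Fin 4)
    (S : Finset Vertex)
    (h : ∀ x ∈ S, ∃ p : Plaquette j, p.base = x ∧ p.dir₁ = c ∧ p.dir₂ = d ∧ g p = G x) :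
    ∑ x ∈ S, G x ^ 2 ≤ ‖g‖ ^ 2 := by
  classical
  rcases S.eq_empty_or_nonempty with rfl | ⟨x₀, hx₀⟩
  · simp
  obtain ⟨p₀, -⟩ := h x₀ hx₀
  have : Nonempty (Plaquette j) := ⟨p₀⟩
  choose! P hbase hdir₁ hdir₂ hval using h
  have hinj : Set.InjOn P S := fun x hx y hy hxy => by
    rw [← hbase x hx, ← hbase y hy, hxy]
  have hle := lp.sum_rpow_le_norm_rpow (by norm_num : 0 < (2 : ENNReal).toReal) g (S.image P)
  simp only [ENNReal.toReal_ofNat, Real.rpow_ofNat] at hle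
  rw [Finset.sum_image hinj] at hle
  refine le_trans (le_of_eq (Finset.sum_congr rfl fun x hx => ?_)) hle
  rw [hval x hx, Real.norm_eq_abs, sq_abs]

theorem smallValue_neg (b u : ℝ) : smallValue b (-u) = -smallValue b u := by
  unfold smallValue
  rw [abs_neg]
  split_ifs <;> simp

theorem inner_eq_tsum_mul {j : ℕ∞} (f g : TwoForm j) : inner ℝ f g = ∑' p, f p * g p := by
  rw [lp.inner_eq_tsum]
  exact tsum_congr fun p => mul_comm _ _

/-- The orientation of the rectangle. -/
def Rectangle.sign (R : Rectangle) : ℝ := if R.dirL < R.dirH then 1 else -1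

/-- Positively oriented cells have increasing directions while `dirL`, `dirH` come in either order;
`R.sign` corrects for this. -/
theorem inner_indicatorForm (R : Rectangle) {j : ℕ∞} (hR : ∀ x ∈ R.vertices, InBox j x)
    (g : TwoForm j) (Θ : Fin 4 → Vertex → ℝ)
    (hg : ∀ p : Plaquette j, g p = curl Θ p.dir₁ p.dir₂ p.base) :
    inner ℝ (R.indicatorForm j) g =
      R.sign * rectSum (curl Θ) R.dirL R.dirH R.length R.height R.corner := by
  classical
  have hval : ∀ p, (R.indicatorForm j) p = if p ∈ R.cells j then 1 else 0 := fun p => rfl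
  rw [inner_eq_tsum_mul, tsum_eq_sum (s := (R.cells_finite j).toFinset) fun p hp => by
    rw [hval, if_neg (by simpa using hp), zero_mul]]
  unfold rectSum
  rw [← Finset.sum_product', Finset.mul_sum]
  have hab := R.dir_ne
  set a := min R.dirL R.dirH with ha
  set b := max R.dirL R.dirH with hb
  have hab' : a < b := min_lt_max.mpr hab
  have hcases : (a = R.dirL ∧ b = R.dirH) ∨ (a = R.dirH ∧ b = R.dirL) := by
    rcases le_total R.dirL R.dirH with h | h
    · exact .inl ⟨min_eq_left h, max_eq_right h⟩
    · exact .inr ⟨min_eq_right h, max_eq_left h⟩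
  have hbox : ∀ s t : ℕ, s ≤ R.length → t ≤ R.height →
      InBox j (R.corner + s • unitVec R.dirL + t • unitVec R.dirH) := fun s t hs ht =>
    hR _ (corner_add_mem_vertices R hs ht)
  have hboxL : ∀ s t : ℕ, s < R.length → t ≤ R.height →
      InBox j (R.corner + s • unitVec R.dirL + t • unitVec R.dirH + unitVec R.dirL) := by
    intro s t hs ht
    have := hbox (s + 1) t hs ht
    rwa [add_smul, one_smul, ← add_assoc, add_right_comm] at this
  have hboxH : ∀ s t : ℕ, s ≤ R.length → t < R.height →
      InBox j (R.corner + s • unitVec R.dirL + t • unitVec R.dirH + unitVec R.dirH) := by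
    intro s t hs ht
    have := hbox s (t + 1) hs ht
    rwa [add_smul, one_smul, ← add_assoc] at this
  have hboxLH : ∀ s t : ℕ, s < R.length → t < R.height →
      InBox j (R.corner + s • unitVec R.dirL + t • unitVec R.dirH + unitVec R.dirL +
        unitVec R.dirH) := by
    intro s t hs ht
    have := hboxL s (t + 1) hs ht
    rwa [add_smul, one_smul, ← add_assoc, add_right_comm _ (unitVec R.dirH)] at this
  symm
  refine Finset.sum_bij (fun q hq => (⟨R.corner + q.1 • unitVec R.dirL + q.2 • unitVec R.dirH, a, b,
    hab', ?_, ?_, ?_, ?_⟩ : Plaquette j)) ?_ ?_ ?_ ?_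
  · simp only [Finset.mem_product, Finset.mem_range] at hq
    exact hbox _ _ hq.1.le hq.2.le
  · simp only [Finset.mem_product, Finset.mem_range] at hq
    rcases hcases with ⟨h1, h2⟩ | ⟨h1, h2⟩
    · rw [h1]; exact hboxL _ _ hq.1 hq.2.le
    · rw [h1]; exact hboxH _ _ hq.1.le hq.2
  · simp only [Finset.mem_product, Finset.mem_range] at hq
    rcases hcases with ⟨h1, h2⟩ | ⟨h1, h2⟩
    · rw [h2]; exact hboxH _ _ hq.1.le hq.2
    · rw [h2]; exact hboxL _ _ hq.1 hq.2.le
  · simp only [Finset.mem_product, Finset.mem_range] at hq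
    rcases hcases with ⟨h1, h2⟩ | ⟨h1, h2⟩
    · rw [h1, h2]; exact hboxLH _ _ hq.1 hq.2
    · rw [h1, h2, add_right_comm]; exact hboxLH _ _ hq.1 hq.2
  · rintro ⟨s, t⟩ hq
    rw [Set.Finite.mem_toFinset, mem_cells_iff]
    simp only [Finset.mem_product, Finset.mem_range] at hq
    exact ⟨s, hq.1, t, hq.2, rfl, hcases⟩
  · rintro ⟨s, t⟩ _ ⟨s', t'⟩ _ hpq
    have hbase := congrArg Plaquette.base hpq
    have h1 := congrFun hbase R.dirL
    have h2 := congrFun hbase R.dirH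
    simp only [Pi.add_apply, nsmul_unitVec_apply, if_true, if_neg hab, if_neg hab.symm] at h1 h2
    ext <;> simp only <;> omega
  · intro p hp
    rw [Set.Finite.mem_toFinset, mem_cells_iff] at hp
    obtain ⟨s, hs, t, ht, hbase, hdirs⟩ := hp
    refine ⟨(s, t), by simp [hs, ht], ?_⟩
    have hlt := p.dir_lt
    have : p.dir₁ = a ∧ p.dir₂ = b := by
      rcases hdirs with ⟨h1, h2⟩ | ⟨h1, h2⟩ <;> rcases hcases with ⟨h3, h4⟩ | ⟨h3, h4⟩ <;>
        simp_all <;> exact absurd hab' (lt_asymm hlt)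
    exact Plaquette.ext hbase.symm this.1.symm this.2.symm
  · rintro ⟨s, t⟩ hq
    simp only [Finset.mem_product, Finset.mem_range] at hq
    rw [hval, if_pos ((mem_cells_iff R _).mpr ⟨s, hq.1, t, hq.2, rfl, hcases⟩), one_mul, hg]
    simp only [Rectangle.sign]
    rcases hcases with ⟨h1, h2⟩ | ⟨h1, h2⟩
    · rw [h1, h2, if_pos (by rw [← h1, ← h2]; exact hab'), one_mul]
    · rw [h1, h2, if_neg (not_lt.mpr (by rw [← h1, ← h2]; exact hab'.le)), curl_swap]
      ring

/-- By antisymmetry, the pairing with the derivative of a one-component form over increasing pairs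
of directions becomes a divergence in the index `c`. -/
theorem sum_lt_eq_of_antisymm (A : Fin 4 → Fin 4 → ℝ) (hA : ∀ c d, A d c = -A c d)
    (u : Fin 4 → ℝ) (k : Fin 4) :
    ∑ c, ∑ d, (if c < d then A c d * ((if d = k then u c else 0) - (if c = k then u d else 0))
      else 0) = ∑ c, A c k * u c := by
  have h0 : ∀ c, A c c = 0 := fun c => by linarith [hA c c]
  simp only [Fin.sum_univ_four]
  fin_cases k <;> simp [h0]
  · rw [hA 0 1, hA 0 2, hA 0 3]; ring
  · rw [hA 1 2, hA 1 3]; ring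
  · rw [hA 2 3]; ring

theorem curl_single (k : Fin 4) (h : Vertex → ℝ) (c d : Fin 4) (x : Vertex) :
    curl (Pi.single k h) c d x = (if d = k then h (x + unitVec c) - h x else 0) -
      (if c = k then h (x + unitVec d) - h x else 0) := by
  simp only [curl, Pi.single_apply]
  split_ifs <;> simp <;> ring

open Classical in
/-- The extension by zero of a `1`-form on `Λ_j` to `ℤ⁴`. -/
noncomputable def extendForm {j : ℕ∞} (θ : Edge j → ℝ) (a : Fin 4) (x : Vertex) : ℝ :=
  if h : InBox j x ∧ InBox j (x + unitVec a) then θ ⟨x, a, h.1, h.2⟩ else 0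

/-- All edges of a cell of `Λ_j` lie in `Λ_j`, so the extension by zero does not alter the
derivative there. It makes Stokes available on all of `ℤ⁴`. -/
theorem curl_extendForm {j : ℕ∞} (θ : Edge j → ℝ) (p : Plaquette j) :
    curl (extendForm θ) p.dir₁ p.dir₂ p.base = extDeriv θ p := by
  have h := p.corner₁₂_mem
  have h' := h
  rw [add_right_comm] at h'
  simp only [curl, extendForm, extDeriv, Plaquette.edge₁, Plaquette.edge₂, Plaquette.edge₁',
    Plaquette.edge₂', p.base_mem, p.corner₁_mem, p.corner₂_mem, h, h', and_self, dif_pos]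

/-- The restriction to `Λ_j` of the `1`-form with the only component `h` in direction `k`. -/
noncomputable def componentForm (j : ℕ∞) (k : Fin 4) (h : Vertex → ℝ) (e : Edge j) : ℝ :=
  (Pi.single k h : Fin 4 → Vertex → ℝ) e.dir e.base

theorem extDeriv_componentForm {j : ℕ∞} (k : Fin 4) (h : Vertex → ℝ) (p : Plaquette j) :
    extDeriv (componentForm j k h) p = curl (Pi.single k h) p.dir₁ p.dir₂ p.base := rfl

theorem near_of_curl_single_ne_zero {R : Rectangle} {M : ℕ} {k : Fin 4} {h : Vertex → ℝ}
    (hh : ∀ x, h x ≠ 0 → R.Near M x) {c d : Fin 4} {x : Vertex}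
    (hx : curl (Pi.single k h) c d x ≠ 0) : R.Near (M + 1) x := by
  by_contra hne
  have h0 : ∀ e, h (x + unitVec e) = 0 := fun e => by
    by_contra he; exact hne (hh _ he).of_add_unitVec
  have h1 : h x = 0 := by
    by_contra he; exact hne ((hh _ he).mono M.le_succ)
  exact hx (by simp [curl_single, h0, h1])

theorem Plaquette.index_injective {j : ℕ∞} : Function.Injective
    fun p : Plaquette j => ((p.base, p.dir₁, p.dir₂) : Vertex × Fin 4 × Fin 4) := by
  intro p q h
  simp only [Prod.mk.injEq] at h
  exact Plaquette.ext h.1 h.2.1 h.2.2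

/-- The exterior derivative of a finitely supported `1`-form with one component. -/
noncomputable def componentDeriv (R : Rectangle) (M : ℕ) (j : ℕ∞) (k : Fin 4) (h : Vertex → ℝ)
    (hh : ∀ x, h x ≠ 0 → R.Near M x) : TwoForm j :=
  ⟨extDeriv (componentForm j k h), by
    refine (memℓp_zero (Set.Finite.subset (((R.finite_near (M + 1)).prod
      (Set.finite_univ (α := Fin 4 × Fin 4))).preimage
        Plaquette.index_injective.injOn) ?_)).of_exponent_ge zero_le
    intro p hp
    exact ⟨near_of_curl_single_ne_zero hh hp, trivial⟩⟩

/-- An edge contained in the boundary has its base on the boundary, which is away from the support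
of `h`; hence the zero boundary condition holds too. -/
theorem componentDeriv_mem {R : Rectangle} {M : ℕ} {j : ℕ∞} (bc : BoundaryCondition) {k : Fin 4}
    {h : Vertex → ℝ} (hh : ∀ x, h x ≠ 0 → R.Near M x)
    (hint : ∀ x, R.Near (M + 2) x → ∀ l, ((x l).natAbs : ℕ∞) < j) :
    componentDeriv R M j k h hh ∈ exactForms bc j := by
  refine ⟨componentForm j k h, ?_, fun _ => rfl⟩
  cases bc
  · trivial
  · rintro e ⟨l, -, hl⟩
    have h0 : h e.base = 0 := by
      by_contra hne
      exact ((hint _ ((hh _ hne).mono (by omega))) l).ne hl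
    simp only [componentForm, Pi.single_apply]
    split_ifs
    · exact h0
    · rfl

theorem inner_componentDeriv {R : Rectangle} {M : ℕ} {j : ℕ∞} {k : Fin 4}
    {h : Vertex → ℝ} (hh : ∀ x, h x ≠ 0 → R.Near M x)
    (hint : ∀ x, R.Near (M + 2) x → ∀ l, ((x l).natAbs : ℕ∞) < j) (f : TwoForm j)
    (Θ : Fin 4 → Vertex → ℝ) (hf : ∀ p : Plaquette j, f p = curl Θ p.dir₁ p.dir₂ p.base) :
    inner ℝ f (componentDeriv R M j k h hh) =
      ∑' x, ∑ c, curl Θ c k x * (h (x + unitVec c) - h x) := by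
  classical
  set φ : Vertex × Fin 4 × Fin 4 → ℝ := fun q =>
    if q.2.1 < q.2.2 then curl Θ q.2.1 q.2.2 q.1 * curl (Pi.single k h) q.2.1 q.2.2 q.1 else 0
    with hφ
  have hφne : ∀ q, φ q ≠ 0 → q.2.1 < q.2.2 ∧ R.Near (M + 1) q.1 := by
    intro q hq
    by_cases hlt : q.2.1 < q.2.2
    · refine ⟨hlt, near_of_curl_single_ne_zero (k := k) hh (c := q.2.1) (d := q.2.2) fun h0 => hq ?_⟩
      simp only [hφ, h0, mul_zero, ite_self]
    · exact absurd (if_neg hlt) hq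
  have h1 : inner ℝ f (componentDeriv R M j k h hh) =
      ∑' p : Plaquette j, φ (p.base, p.dir₁, p.dir₂) := by
    rw [inner_eq_tsum_mul]
    refine tsum_congr fun p => ?_
    simp only [hφ, if_pos p.dir_lt, hf]
    rfl
  -- The support of `φ` consists of increasing pairs of directions at points near `R`, and these all
  -- come from cells of `Λ_j`.
  have h2 : ∑' p : Plaquette j, φ (p.base, p.dir₁, p.dir₂) = ∑' q, φ q := by
    refine Plaquette.index_injective.tsum_eq (f := φ) fun q hq => ?_
    obtain ⟨hlt, hnear⟩ := hφne q hq
    obtain ⟨p, hp1, hp2, hp3⟩ := exists_plaquette (j := j)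
      (fun x hx l => (hint x hx l).le) hnear hlt
    exact ⟨p, by simp only [hp1, hp2, hp3]⟩
  set X := (R.finite_near (M + 1)).toFinset with hX
  have h3 : ∑' q, φ q = ∑ x ∈ X, ∑ c, ∑ d, φ (x, c, d) := by
    rw [tsum_eq_sum (s := X ×ˢ Finset.univ ×ˢ Finset.univ)]
    · simp only [Finset.sum_product]
    · intro q hq
      by_contra hne
      exact hq (by simpa [hX] using (hφne q hne).2)
  rw [h1, h2, h3, tsum_eq_sum (s := X)]
  · refine Finset.sum_congr rfl fun x _ => ?_
    rw [← sum_lt_eq_of_antisymm (fun c d => curl Θ c d x) (fun c d => curl_swap Θ c d x)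
      (fun c => h (x + unitVec c) - h x) k]
    simp only [hφ, curl_single]
  · intro x hx
    have hx' : ¬ R.Near (M + 1) x := by simpa [hX] using hx
    have h0 : ∀ e, h (x + unitVec e) = 0 := fun e => by
      by_contra he; exact hx' (hh _ he).of_add_unitVec
    have h1 : h x = 0 := by
      by_contra he; exact hx' ((hh _ he).mono M.le_succ)
    simp [h0, h1]

/-- `Θ` is a potential of the projection, extended by zero. Testing the projection identity with the
projection itself gives `flux`; testing it with one-component forms supported near `R` gives `weak`.
-/
theorem exists_isLocalProjection (R : Rectangle) (M : ℕ) (bc : BoundaryCondition) (j : ℕ∞)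
    (b : ℝ) (hint : ∀ x, R.Near (M + 2) x → ∀ l, ((x l).natAbs : ℕ∞) < j) :
    ∃ Θ, IsLocalProjection R M b Θ R.sign (‖proj₁₂ bc j (R.indicatorForm j)‖ ^ 2)
      (‖smallPart b (proj₁₂ bc j (R.indicatorForm j))‖ ^ 2) := by
  have hR : ∀ x ∈ R.vertices, InBox j x := fun x hx l =>
    (hint x (Rectangle.Near.mono (Nat.zero_le _) (Rectangle.near_zero_iff.mpr hx)) l).le
  set f := proj₁₂ bc j (R.indicatorForm j) with hf
  have hmem : f ∈ exactForms bc j := (exactForms bc j).starProjection_apply_mem _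
  obtain ⟨θ, -, hθ⟩ := id hmem
  have hcurl : ∀ p : Plaquette j, f p = curl (extendForm θ) p.dir₁ p.dir₂ p.base := fun p => by
    rw [hθ, curl_extendForm]
  have hproj : ∀ g ∈ exactForms bc j, inner ℝ f g = inner ℝ (R.indicatorForm j) g := by
    intro g hg
    rw [hf, proj₁₂, Submodule.inner_starProjection_left_eq_right,
      Submodule.starProjection_eq_self_iff.mpr hg]
  have hplaq : ∀ {c d : Fin 4}, c < d → ∀ x, R.Near (M + 1) x →
      ∃ p : Plaquette j, p.base = x ∧ p.dir₁ = c ∧ p.dir₂ = d :=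
    fun hcd x hx => exists_plaquette (fun x hx l => (hint x hx l).le) hx hcd
  have hsum : ∀ c d (S : Finset Vertex), (∀ x ∈ S, R.Near (M + 1) x) →
      c < d → ∑ x ∈ S, curl (extendForm θ) c d x ^ 2 ≤ ‖f‖ ^ 2 := by
    intro c d S hS hcd
    refine sum_sq_le_norm_sq f _ c d S fun x hx => ?_
    obtain ⟨p, rfl, rfl, rfl⟩ := hplaq hcd x (hS x hx)
    exact ⟨p, rfl, rfl, rfl, hcurl p⟩
  have hsmall : ∀ c d (S : Finset Vertex), (∀ x ∈ S, R.Near (M + 1) x) →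
      c < d → ∑ x ∈ S, smallValue b (curl (extendForm θ) c d x) ^ 2 ≤ ‖smallPart b f‖ ^ 2 := by
    intro c d S hS hcd
    refine sum_sq_le_norm_sq (smallPart b f) _ c d S fun x hx => ?_
    obtain ⟨p, rfl, rfl, rfl⟩ := hplaq hcd x (hS x hx)
    refine ⟨p, rfl, rfl, rfl, ?_⟩
    rw [← hcurl p]
    rfl
  refine ⟨extendForm θ, ⟨fun c d S hS => ?_, fun c d S hS => ?_, ?_, ?_, fun k h hh => ?_⟩⟩
  · rcases lt_trichotomy c d with hcd | rfl | hcd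
    · exact hsum c d S hS hcd
    · simp only [curl_self]
      simp
    · simp only [curl_swap (extendForm θ) d c, neg_sq]
      exact hsum d c S hS hcd
  · rcases lt_trichotomy c d with hcd | rfl | hcd
    · exact hsmall c d S hS hcd
    · simp only [curl_self, smallValue]
      simp
    · simp only [curl_swap (extendForm θ) d c, smallValue_neg, neg_sq]
      exact hsmall d c S hS hcd
  · unfold Rectangle.sign
    split_ifs <;> simp
  · rw [← inner_indicatorForm R hR f _ hcurl, ← hproj f hmem, real_inner_self_eq_norm_sq]
  · rw [← inner_componentDeriv hh hint f _ hcurl, hproj _ (componentDeriv_mem bc hh hint),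
      inner_indicatorForm R hR _ (Pi.single k h) fun p => extDeriv_componentForm k h p]

/-! ### Perimeter bound and conclusion -/

/-- The square norm of the projection is at most proportional to the perimeter. -/
theorem IsLocalProjection.norm_sq_le {R : Rectangle} {M : ℕ} {b : ℝ} {Θ : Fin 4 → Vertex → ℝ}
    {σ Nf Ns : ℝ} (hF : IsLocalProjection R M b Θ σ Nf Ns) (hL : 0 < R.length)
    (hM : R.length ≤ M + 2) : Nf ≤ 66 ^ 2 * (R.length + R.height) := by
  have hNf : 0 ≤ Nf := by simpa using hF.sum_sq_le 0 0 ∅ (by simp)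
  have h := sq_rectSum_le (Θ := Θ) (N := Nf) (a := R.dirL) (b := R.dirH) (L := R.length)
    (H := R.height) (x₀ := R.corner) R.dir_ne hL le_rfl fun c d S hS =>
      hF.sum_sq_le c d S fun x hx => by
        obtain ⟨v, s, hs, t, ht, hv, rfl⟩ := hS x hx
        refine ⟨_, corner_add_mem_vertices R hs ht, fun l => ?_⟩
        have := hv l
        simp only [Pi.add_apply, abs_le]
        push_cast
        constructor <;> omega
  -- The flux is itself `± Nf`, so the flux bound is quadratic in `Nf` on the left and linear on the
  -- right.
  have h2 : Nf ^ 2 ≤ 66 ^ 2 * (R.length + R.height) * Nf := by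
    calc Nf ^ 2 = |σ| ^ 2 *
          rectSum (curl Θ) R.dirL R.dirH R.length R.height R.corner ^ 2 := by
          rw [sq_abs, ← mul_pow, hF.flux]
      _ ≤ _ := by rw [hF.abs_sign, one_pow, one_mul]; exact h
  rcases hNf.eq_or_lt with h0 | h0
  · rw [← h0]; positivity
  · rw [sq] at h2
    exact le_of_mul_le_mul_right h2 h0

end LatticeGauge

/-- The shape condition enters only in this weak form, which ensures that a rectangle with one
bounded side has both sides bounded. -/
theorem Real.natCast_le_sq_of_rpow {L H : ℕ} (hL : 0 < L)
    (h₁ : (L : ℝ) ^ (3 / 4 : ℝ) ≤ H) (h₂ : (H : ℝ) ≤ (L : ℝ) ^ (4 / 3 : ℝ)) :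
    H ≤ L ^ 2 ∧ L ≤ H ^ 2 := by
  have hL1 : (1 : ℝ) ≤ L := by exact_mod_cast hL
  have hL0 : (0 : ℝ) ≤ L := by positivity
  constructor
  · have : (L : ℝ) ^ (4 / 3 : ℝ) ≤ (L : ℝ) ^ (2 : ℝ) :=
      Real.rpow_le_rpow_of_exponent_le hL1 (by norm_num)
    rw [Real.rpow_two] at this
    exact_mod_cast h₂.trans this
  · have h3 : (L : ℝ) ^ (1 / 2 : ℝ) ≤ (L : ℝ) ^ (3 / 4 : ℝ) :=
      Real.rpow_le_rpow_of_exponent_le hL1 (by norm_num)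
    rw [← Real.sqrt_eq_rpow] at h3
    have h4 := h3.trans h₁
    rw [Real.sqrt_le_left (by positivity)] at h4
    exact_mod_cast h4

open LatticeGauge in
-- `n` and `n'` are chosen so that the sets with a large value cannot use up all shells: at least
-- `A` of the `A * n` shells remain around a longer side of length `A`, and at least one of the `n'`
-- shells around a small rectangle.
theorem LatticeGauge.exists_norm_sq_le (b : ℝ) (hb : 0 < b) :
    ∃ K : ℝ, 0 < K ∧ ∃ D : ℕ, ∀ (R : Rectangle) (M : ℕ) (Θ : Fin 4 → Vertex → ℝ) (σ Nf Ns : ℝ),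
      0 < R.length → 0 < R.height → R.height ≤ R.length ^ 2 → R.length ≤ R.height ^ 2 →
      R.length ≤ M + 2 → D ≤ M → IsLocalProjection R M b Θ σ Nf Ns → Nf ≤ K * Ns := by
  obtain ⟨n, hn⟩ := exists_nat_ge (32 * 66 ^ 2 / b ^ 2 + 1)
  set q := (2 * n) ^ 2 with hq
  obtain ⟨n', hn'⟩ := exists_nat_ge (32 * 66 ^ 2 * q / b ^ 2 + 1)
  set c₁ : ℝ := 1 ^ 2 * (16 * (4 * n + 1 : ℝ) ^ 4) * 16 with hc₁
  set c₂ : ℝ := (16 * (q + n')) ^ 2 * (16 * (4 * (q + n') + 1 : ℝ) ^ 4) * 16 with hc₂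
  have hc₁0 : 0 < c₁ := by positivity
  have hc₂0 : 0 ≤ c₂ := by positivity
  refine ⟨2 * 66 ^ 2 * c₁ + 2 * 66 ^ 2 * q * c₂, by positivity, 2 * (q + n') + 2 * n, ?_⟩
  intro R M Θ σ Nf Ns hL hH hHL hLH hLM hDM hF
  have hNf := hF.norm_sq_le hL hLM
  have hNs : 0 ≤ Ns := by simpa using hF.sum_small_sq_le 0 0 ∅ (by simp)
  have hlong : ∀ A : ℕ, R.length ≤ A → R.height ≤ A →
      (A * n : ℝ) ≤ 1 ^ 2 * (16 * (4 * n + 1 : ℝ) ^ 4) * (16 * Ns) + 16 * Nf / b ^ 2 →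
      Nf ≤ 2 * 66 ^ 2 * c₁ * Ns := by
    intro A hLA hHA hA
    have hLA' : (R.length : ℝ) ≤ A := by exact_mod_cast hLA
    have hHA' : (R.height : ℝ) ≤ A := by exact_mod_cast hHA
    have hNA : Nf ≤ 66 ^ 2 * (2 * A) := hNf.trans (by linarith)
    have h1 : 16 * Nf / b ^ 2 ≤ A * (32 * 66 ^ 2 / b ^ 2) := by
      rw [← mul_div_assoc]
      exact div_le_div_of_nonneg_right (by linarith) (by positivity)
    have h2 : (A : ℝ) * (32 * 66 ^ 2 / b ^ 2 + 1) ≤ A * n := by gcongr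
    have h3 : (A : ℝ) ≤ c₁ * Ns := by
      rw [hc₁]; linarith
    linarith
  have hc₂q : 0 ≤ 2 * 66 ^ 2 * q * c₂ * Ns := by positivity
  have hc₁q : 0 ≤ 2 * 66 ^ 2 * c₁ * Ns := by positivity
  rw [add_mul]
  by_cases hlarge : 2 * n ≤ R.length ∧ 2 * n ≤ R.height
  · rcases le_total R.length R.height with hle | hle
    · have := hlong R.height hle le_rfl (height_mul_le hF hb n hlarge.1 (by omega))
      linarith
    · have := hlong R.length le_rfl hle
        (height_mul_le hF.swap hb n (show 2 * n ≤ R.swap.length from hlarge.2) (by omega))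
      linarith
  -- One side is shorter than `2 * n`, so the other is at most its square, hence at most `q`.
  · have hqLH : R.length ≤ q ∧ R.height ≤ q := by
      rw [hq]
      rcases not_and_or.mp hlarge with h | h
      · push Not at h
        have h2 : R.length ^ 2 ≤ (2 * n) ^ 2 := Nat.pow_le_pow_left h.le 2
        exact ⟨(Nat.le_self_pow two_ne_zero _).trans h2, hHL.trans h2⟩
      · push Not at h
        have h2 : R.height ^ 2 ≤ (2 * n) ^ 2 := Nat.pow_le_pow_left h.le 2
        exact ⟨hLH.trans h2, (Nat.le_self_pow two_ne_zero _).trans h2⟩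
    have hcount := count_le_of_small hF hb q n' hqLH.1 hqLH.2 hL hH (by omega)
    have hLq : (R.length : ℝ) ≤ q := by exact_mod_cast hqLH.1
    have hHq : (R.height : ℝ) ≤ q := by exact_mod_cast hqLH.2
    have hNq : Nf ≤ 66 ^ 2 * (2 * q) := hNf.trans (by linarith)
    have h1 : 16 * Nf / b ^ 2 ≤ 32 * 66 ^ 2 * q / b ^ 2 :=
      div_le_div_of_nonneg_right (by linarith) (by positivity)
    have h3 : 1 ≤ c₂ * Ns := by
      rw [hc₂]; linarith
    have h4 : 2 * 66 ^ 2 * (q : ℝ) * 1 ≤ 2 * 66 ^ 2 * q * (c₂ * Ns) := by gcongr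
    linarith

theorem propositionp :
    ∀ b : ℝ, 0 < b → ∃ C : ℝ, 0 < C ∧ ∃ D : ℕ,
      ∀ (bc : LatticeGauge.BoundaryCondition) (j : ℕ∞) (R : LatticeGauge.Rectangle),
        (∀ x ∈ R.vertices, LatticeGauge.InBox j x) →
        (R.length : ℝ) ^ (3 / 4 : ℝ) ≤ (R.height : ℝ) →
        (R.height : ℝ) ≤ (R.length : ℝ) ^ (4 / 3 : ℝ) →
        R.FarFromBoundary j (R.length : ℝ) →
        R.FarFromBoundary j (D : ℝ) →
        C * ‖LatticeGauge.proj₁₂ bc j (R.indicatorForm j)‖ ^ 2 ≤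
          ‖LatticeGauge.smallPart b (LatticeGauge.proj₁₂ bc j (R.indicatorForm j))‖ ^ 2 := by
  intro b hb
  obtain ⟨K, hK, D, hD⟩ := LatticeGauge.exists_norm_sq_le b hb
  refine ⟨K⁻¹, inv_pos.mpr hK, D + 2, fun bc j R hR h₁ h₂ hfarL hfarD => ?_⟩
  -- Two units of the distance to the boundary are reserved for the neighbours of the support of a
  -- test function and the corners of their cells.
  set M := max R.length (D + 2) - 2 with hM
  have hM2 : M + 2 = max R.length (D + 2) := by omega
  have hfar : R.FarFromBoundary j ((M + 2 : ℕ) : ℝ) := by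
    rw [hM2]
    rcases max_choice R.length (D + 2) with h | h <;> rw [h]
    · exact hfarL
    · exact hfarD
  obtain ⟨Θ, hF⟩ := LatticeGauge.exists_isLocalProjection R M bc j b
    fun x hx l => hx.natAbs_lt hR hfar l
  rw [inv_mul_le_iff₀ hK]
  -- A rectangle of length zero has no cells, and its flux, hence the norm of the projection,
  -- vanishes.
  rcases Nat.eq_zero_or_pos R.length with hL | hL
  · rw [← hF.flux, hL]
    simp only [LatticeGauge.rectSum, Finset.range_zero, Finset.sum_empty, mul_zero]
    positivity
  · have hH : 0 < R.height := by
      have : (0 : ℝ) < (R.length : ℝ) ^ (3 / 4 : ℝ) := Real.rpow_pos_of_pos (by exact_mod_cast hL) _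
      exact_mod_cast this.trans_le h₁
    obtain ⟨h3, h4⟩ := Real.natCast_le_sq_of_rpow hL h₁ h₂
    exact hD R M Θ _ _ _ hL hH h3 h4 (by omega) (by omega) hF
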